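/- Let $\mathfrak{sl}(2)$ be the Lie algebra of traceless complex $2\times 2$ matrices with Chevalley basis $e,f,h$ ($[e,f]=h$, $[h,e]=2e$, $[h,f]=-2f$), and put $L_{-1}=f$, $L_0=-\tfrac12 h$, $L_1=-e$. Every $\mathfrak{sl}(2)$-module $V$ is a $\mathbb{C}[z]$-module with $z$ acting as $L_0$; $V$ is called *torsion free*, respectively *of finite rank*, if it is so over $\mathbb{C}[z]$. It is called *rational* if its $\mathbb{C}[z]$-module structure is (the restriction of) that of a finite-dimensional $\mathbb{C}(z)$-vector space, and *Casimir* if the Casimir operator $C=L_0(L_0-1)-L_{-1}L_1$ acts on it as a scalar $\mu\in\mathbb{C}$. Let $\mathcal{R}$ be the class of rational modules and $\mathcal{RC}$ the class of rational Casimir modules. For $\mathcal A=\mathcal R$ or $\mathcal{RC}$, a module $W$ in $\mathcal A$ is *$\mathcal A$-irreducible* if $W\neq 0$ and the only $\mathfrak{sl}(2)$-submodules of $W$ that belong to $\mathcal A$ are $0$ and $W$. Write $\widehat{\mathrm{Spl}}_{\mathcal A}(\mathcal A)$ for the isomorphism classes of $\mathcal A$-irreducible modules, and $\widehat{\mathrm{Spl}}(\mathfrak{sl}(2)\text{-}\mathrm{Mod}_{\mathrm{tf}})$,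 $\widehat{\mathrm{Spl}}(\mathfrak{sl}(2)\text{-}\mathrm{Mod}_{\mathrm{tffr}})$ for the isomorphism classes of simple $\mathfrak{sl}(2)$-modules that are torsion free, respectively torsion free of finite rank. The *rationalization* $F_{\mathrm{rat}}(V)$ of a module $V$ is the localization $S^{-1}V$, $S=\mathbb{C}[z]\setminus\{0\}$, with the $\mathfrak{sl}(2)$-action $$L_{-1}\frac{v}{p(z)}=\frac{L_{-1}v}{p(z-1)},\qquad L_{0}\frac{v}{p(z)}=\frac{L_0v}{p(z)},\qquad L_{1}\frac{v}{p(z)}=\frac{L_{1}v}{p(z+1)}.$$ **Theorem.** One has $$\widehat{\mathrm{Spl}}(\mathfrak{sl}(2)\text{-}\mathrm{Mod}_{\mathrm{tf}})=\widehat{\mathrm{Spl}}(\mathfrak{sl}(2)\text{-}\mathrm{Mod}_{\mathrm{tffr}})\xrightarrow[\ \sim\ ]{\widehat F_{\mathrm{rat}}}\widehat{\mathrm{Spl}}_{\mathcal{RC}}(\mathcal{RC})=\widehat{\mathrm{Spl}}_{\mathcal R}(\mathcal R),$$ where the middle map, induced by $V\mapsto F_{\mathrm{rat}}(V)$, is a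 bijection and the outer two equalities are equalities of sets of isomorphism classes of $\mathfrak{sl}(2)$-modules. Moreover, every $\mathcal R$-irreducible rational module is Casimir. -/

import Mathlib

universe u v

noncomputable section

open Polynomial

namespace SlTwo

/-! ### The Lie algebra and its distinguished elements -/

/-- The complex Lie algebra `sl(2)` of traceless `2 × 2` matrices. -/
abbrev sl2 : Type := ↥(LieAlgebra.SpecialLinear.sl (Fin 2) ℂ)

/-- `e = E₁₂`. -/
def eElt : sl2 := LieAlgebra.SpecialLinear.single 0 1 (by decide) 1

/-- `f = E₂₁`. -/
def fElt : sl2 := LieAlgebra.SpecialLinear.single 1 0 (by decide) 1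

/-- `h = E₁₁ - E₂₂`. -/
def hElt : sl2 := LieAlgebra.SpecialLinear.singleSubSingle 0 1 1

/-- `L₋₁ = f`. -/
def Lneg : sl2 := fElt

/-- `L₀ = -h/2`. -/
def Lzero : sl2 := -((1 / 2 : ℂ) • hElt)

/-- `L₁ = -e`. -/
def Lpos : sl2 := -eElt

lemma sl2_ext_iff (x y : sl2) :
    x = y ↔ x.1 0 0 = y.1 0 0 ∧ x.1 0 1 = y.1 0 1 ∧ x.1 1 0 = y.1 1 0 := by
  constructor
  · rintro rfl; exact ⟨rfl, rfl, rfl⟩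
  · rintro ⟨h00, h01, h10⟩
    have hx : x.1 0 0 + x.1 1 1 = 0 := by
      have := x.2
      rw [← Matrix.trace_fin_two]; exact this
    have hy : y.1 0 0 + y.1 1 1 = 0 := by
      have := y.2
      rw [← Matrix.trace_fin_two]; exact this
    apply Subtype.ext
    ext i j
    fin_cases i <;> fin_cases j
    · exact h00
    · exact h01
    · exact h10
    · change x.1 1 1 = y.1 1 1
      rw [eq_neg_of_add_eq_zero_right hx, eq_neg_of_add_eq_zero_right hy, h00]

lemma sl2_apply_one_one (x : sl2) : x.1 1 1 = -x.1 0 0 := by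
  have hx : x.1 0 0 + x.1 1 1 = 0 := by
    have := x.2
    rw [← Matrix.trace_fin_two]; exact this
  exact eq_neg_of_add_eq_zero_right hx

lemma lie_apply (x y : sl2) (i j : Fin 2) :
    (⁅x, y⁆ : sl2).1 i j = (x.1 * y.1) i j - (y.1 * x.1) i j := rfl

lemma lie_e_f : ⁅eElt, fElt⁆ = hElt := by
  rw [sl2_ext_iff]
  simp [lie_apply, eElt, fElt, hElt, Matrix.mul_apply, Matrix.single]

lemma lie_h_e : ⁅hElt, eElt⁆ = (2 : ℂ) • eElt := by
  rw [sl2_ext_iff]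
  simp [lie_apply, eElt, hElt, Matrix.mul_apply, Matrix.single]
  norm_num

lemma lie_h_f : ⁅hElt, fElt⁆ = (-2 : ℂ) • fElt := by
  rw [sl2_ext_iff]
  simp [lie_apply, fElt, hElt, Matrix.mul_apply, Matrix.single]
  norm_num

lemma lie_zero_pos : ⁅Lzero, Lpos⁆ = -Lpos := by
  simp [Lzero, Lpos, lie_h_e]

lemma lie_zero_neg : ⁅Lzero, Lneg⁆ = Lneg := by
  simp [Lzero, Lneg, lie_h_f]

lemma lie_neg_pos : ⁅Lneg, Lpos⁆ = (-2 : ℂ) • Lzero := by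
  rw [Lneg, Lpos, Lzero, lie_neg, lie_skew, lie_e_f]
  simp

lemma sl2_decomp (x : sl2) :
    x = (x.1 0 1) • (-Lpos) + (x.1 1 0) • Lneg + (x.1 0 0) • ((-2 : ℂ) • Lzero) := by
  rw [sl2_ext_iff]
  simp [Lpos, Lneg, Lzero, eElt, fElt, hElt, Matrix.single]

/-! ### `sl(2)`-modules as `ℂ[z]`-modules -/

section OneModule

variable (V : Type u) [AddCommGroup V] [Module ℂ V] [LieRingModule sl2 V] [LieModule ℂ sl2 V]

/-- The operator by which an element of `sl(2)` acts. -/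
abbrev act (x : sl2) : Module.End ℂ V := LieModule.toEnd ℂ sl2 V x

/-- `V` as a `ℂ[z]`-module, the variable acting by `L₀`. -/
abbrev PolyMod : Type u := Module.AEval' (act V Lzero)

/-- The Casimir operator `L₀ (L₀ - 1) - L₋₁ L₁`. -/
def casimir : Module.End ℂ V :=
  act V Lzero * (act V Lzero - 1) - act V Lneg * act V Lpos

/-- Torsion free as a `ℂ[z]`-module. -/
def IsTorsionFree : Prop := Module.IsTorsionFree ℂ[X] (PolyMod V)

/-- Finite rank as a `ℂ[z]`-module. -/
def IsFiniteRank : Prop := Module.rank ℂ[X] (PolyMod V) < Cardinal.aleph0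

/-- Casimir module: the Casimir operator is multiplication by some level `μ`. -/
def IsCasimir : Prop := ∃ μ : ℂ, casimir V = μ • (1 : Module.End ℂ V)

/-- Rational module: the `ℂ[z]`-module structure comes from a structure of finite-dimensional
vector space over the field `ℂ(z)`. -/
def IsRational : Prop :=
  ∃ _ : Module (RatFunc ℂ) (PolyMod V),
    IsScalarTower ℂ[X] (RatFunc ℂ) (PolyMod V) ∧ Module.Finite (RatFunc ℂ) (PolyMod V)

end OneModule

/-! ### Localization of semilinear maps -/

/-- The ring endomorphism `p(z) ↦ p(z + k)` of `ℂ[z]`. -/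
def shift (k : ℂ) : ℂ[X] →+* ℂ[X] := (taylorAlgHom k : ℂ[X] →ₐ[ℂ] ℂ[X]).toRingHom

lemma shift_apply (k : ℂ) (p : ℂ[X]) : shift k p = p.comp (X + C k) := rfl

lemma shift_mem (k : ℂ) {p : ℂ[X]} (hp : p ∈ nonZeroDivisors ℂ[X]) :
    shift k p ∈ nonZeroDivisors ℂ[X] := by
  rw [mem_nonZeroDivisors_iff_ne_zero] at hp ⊢
  intro h
  exact hp (taylor_injective k (by rw [map_zero]; exact h))

/-- The denominator `p(z + k)`. -/
def shiftDen (k : ℂ) (s : nonZeroDivisors ℂ[X]) : nonZeroDivisors ℂ[X] :=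
  ⟨shift k s.1, shift_mem k s.2⟩

/-- The localization `S⁻¹M` of a `ℂ[z]`-module at `S = ℂ[z] ∖ {0}`. -/
abbrev Loc (M : Type u) [AddCommGroup M] [Module ℂ[X] M] : Type u :=
  LocalizedModule (nonZeroDivisors ℂ[X]) M

lemma shiftDen_shiftDen (k l : ℂ) (s : nonZeroDivisors ℂ[X]) :
    shiftDen k (shiftDen l s) = shiftDen (k + l) s := by
  apply Subtype.ext
  change (s.1.comp (X + C l)).comp (X + C k) = s.1.comp (X + C (k + l))
  rw [comp_assoc]
  congr 1
  simp [add_assoc]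

lemma loc_mk_sub_mk {M : Type u} [AddCommGroup M] [Module ℂ[X] M] (m m' : M) (s : nonZeroDivisors ℂ[X]) :
    (LocalizedModule.mk m s : Loc M) - LocalizedModule.mk m' s = LocalizedModule.mk (m - m') s := by
  rw [sub_eq_iff_eq_add, LocalizedModule.mk_add_mk, LocalizedModule.mk_eq]
  refine ⟨1, ?_⟩
  simp only [Submonoid.smul_def, one_smul, mul_smul, ← smul_add, sub_add_cancel]

section Localize

variable {M : Type u} [AddCommGroup M] [Module ℂ M] [Module ℂ[X] M] [IsScalarTower ℂ ℂ[X] M]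
variable {N : Type v} [AddCommGroup N] [Module ℂ N] [Module ℂ[X] N] [IsScalarTower ℂ ℂ[X] N]

lemma loc_smul_mk (c : ℂ) (m : M) (s : nonZeroDivisors ℂ[X]) :
    c • (LocalizedModule.mk m s : Loc M) = LocalizedModule.mk (c • m) s := by
  rw [← algebraMap_smul ℂ[X] c (LocalizedModule.mk m s : Loc M), LocalizedModule.smul'_mk,
    algebraMap_smul]

/-- A `ℂ`-linear map is semilinear for `p(z) ↦ p(z + k)`. -/
def IsShiftLinear (k : ℂ) (f : M →ₗ[ℂ] N) : Prop :=
  ∀ (p : ℂ[X]) (m : M), f (p • m) = shift k p • f m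

/-- The localization `m / p(z) ↦ f(m) / p(z + k)` of a semilinear map. -/
def locMap (k : ℂ) (f : M →ₗ[ℂ] N) (hf : IsShiftLinear k f) : Loc M →ₗ[ℂ] Loc N where
  toFun x := LocalizedModule.liftOn x
    (fun y => LocalizedModule.mk (f y.1) (shiftDen k y.2)) (by
      rintro ⟨m, s⟩ ⟨m', s'⟩ ⟨c, hc⟩
      rw [LocalizedModule.mk_eq]
      refine ⟨shiftDen k c, ?_⟩
      have := congrArg f hc
      simp only [Submonoid.smul_def] at this ⊢
      simpa only [hf _ _, shiftDen] using this)
  map_add' x y := by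
    induction x using LocalizedModule.induction_on with | _ m s
    induction y using LocalizedModule.induction_on with | _ m' s'
    rw [LocalizedModule.mk_add_mk, LocalizedModule.liftOn_mk, LocalizedModule.liftOn_mk,
      LocalizedModule.liftOn_mk, LocalizedModule.mk_add_mk]
    simp only [Submonoid.smul_def, map_add, hf _ _]
    congr 1
    exact Subtype.ext (map_mul (shift k) _ _)
  map_smul' c x := by
    induction x using LocalizedModule.induction_on with | _ m s
    rw [loc_smul_mk, LocalizedModule.liftOn_mk, LocalizedModule.liftOn_mk, RingHom.id_apply,
      loc_smul_mk, map_smul]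

lemma locMap_mk (k : ℂ) (f : M →ₗ[ℂ] N) (hf : IsShiftLinear k f) (m : M)
    (s : nonZeroDivisors ℂ[X]) :
    locMap k f hf (LocalizedModule.mk m s) = LocalizedModule.mk (f m) (shiftDen k s) := rfl

end Localize

/-! ### The rationalization -/

section Rationalization

variable (V : Type u) [AddCommGroup V] [Module ℂ V] [LieRingModule sl2 V] [LieModule ℂ sl2 V]

/-- An operator on `V`, on the underlying space of the associated `ℂ[z]`-module. -/
def polyAct (x : sl2) : PolyMod V →ₗ[ℂ] PolyMod V :=
  (Module.AEval'.of (act V Lzero)).toLinearMap ∘ₗ act V x ∘ₗ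
    (Module.AEval'.of (act V Lzero)).symm.toLinearMap

lemma polyAct_of (x : sl2) (v : V) :
    polyAct V x (Module.AEval'.of (act V Lzero) v) = Module.AEval'.of (act V Lzero) ⁅x, v⁆ := rfl

lemma polyAct_lie (x y : sl2) (m : PolyMod V) :
    polyAct V ⁅x, y⁆ m = polyAct V x (polyAct V y m) - polyAct V y (polyAct V x m) := by
  obtain ⟨v, rfl⟩ := (Module.AEval'.of (act V Lzero)).surjective m
  simp only [polyAct_of, lie_lie, map_sub]

lemma polyAct_smul (c : ℂ) (x : sl2) (m : PolyMod V) :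
    polyAct V (c • x) m = c • polyAct V x m := by
  obtain ⟨v, rfl⟩ := (Module.AEval'.of (act V Lzero)).surjective m
  simp only [polyAct_of, smul_lie, map_smul]

variable {V} in
lemma isShiftLinear_of_X {W : Type v} [AddCommGroup W] [Module ℂ W] [LieRingModule sl2 W]
    [LieModule ℂ sl2 W] (k : ℂ) (f : PolyMod V →ₗ[ℂ] PolyMod W)
    (h : ∀ m, f ((X : ℂ[X]) • m) = (X + C k : ℂ[X]) • f m) : IsShiftLinear k f := by
  intro p
  induction p using Polynomial.induction_on with
  | C a =>
    intro m
    rw [shift_apply, C_comp, C_eq_algebraMap, algebraMap_smul, algebraMap_smul, map_smul]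
  | add p q hp hq => intro m; simp only [add_smul, map_add, hp, hq]
  | monomial n a ih =>
    intro m
    rw [pow_succ, ← mul_assoc, mul_smul, ih, h,
      map_mul (shift k) (C a * X ^ n) X, mul_smul, shift_apply k X, X_comp]

lemma polyAct_lie_X (x : sl2) (k : ℂ) (hx : ⁅Lzero, x⁆ = -k • x) :
    IsShiftLinear k (polyAct V x) := by
  apply isShiftLinear_of_X
  intro m
  have h : ∀ v : V, ⁅x, ⁅Lzero, v⁆⁆ = ⁅Lzero, ⁅x, v⁆⁆ + k • ⁅x, v⁆ := by
    intro v
    have := leibniz_lie Lzero x v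
    rw [hx, smul_lie] at this
    rw [this]
    module
  obtain ⟨v, rfl⟩ := (Module.AEval'.of (act V Lzero)).surjective m
  rw [add_smul, C_eq_algebraMap, algebraMap_smul, polyAct_of, Module.AEval'.X_smul_of,
    Module.AEval'.X_smul_of, polyAct_of, ← map_smul, ← map_add]
  exact congrArg _ (h v)

/-- The underlying space `S⁻¹V` of the rationalization. -/
abbrev RatSpace : Type u := Loc (PolyMod V)

lemma shiftLinear_pos : IsShiftLinear 1 (polyAct V Lpos) :=
  polyAct_lie_X V _ _ (by rw [lie_zero_pos]; module)

lemma shiftLinear_zero : IsShiftLinear 0 (polyAct V Lzero) :=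
  polyAct_lie_X V _ _ (by simp)

lemma shiftLinear_neg : IsShiftLinear (-1) (polyAct V Lneg) :=
  polyAct_lie_X V _ _ (by rw [lie_zero_neg]; module)

/-- `v / p(z) ↦ L₁ v / p(z + 1)`. -/
def ratPos : Module.End ℂ (RatSpace V) := locMap 1 (polyAct V Lpos) (shiftLinear_pos V)

/-- `v / p(z) ↦ z v / p(z)`. -/
def ratZero : Module.End ℂ (RatSpace V) := locMap 0 (polyAct V Lzero) (shiftLinear_zero V)

/-- `v / p(z) ↦ L₋₁ v / p(z - 1)`. -/
def ratNeg : Module.End ℂ (RatSpace V) := locMap (-1) (polyAct V Lneg) (shiftLinear_neg V)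

lemma ratPos_mk (m : PolyMod V) (s : nonZeroDivisors ℂ[X]) :
    ratPos V (LocalizedModule.mk m s) =
      LocalizedModule.mk (polyAct V Lpos m) (shiftDen 1 s) := rfl

lemma ratZero_mk (m : PolyMod V) (s : nonZeroDivisors ℂ[X]) :
    ratZero V (LocalizedModule.mk m s) = LocalizedModule.mk (polyAct V Lzero m) s := by
  have : shiftDen 0 s = s := Subtype.ext (by simp [shiftDen, shift_apply])
  change LocalizedModule.mk (polyAct V Lzero m) (shiftDen 0 s) = _
  rw [this]

lemma ratNeg_mk (m : PolyMod V) (s : nonZeroDivisors ℂ[X]) :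
    ratNeg V (LocalizedModule.mk m s) =
      LocalizedModule.mk (polyAct V Lneg m) (shiftDen (-1) s) := rfl

lemma ratZero_ratPos : ratZero V * ratPos V - ratPos V * ratZero V = -ratPos V := by
  ext x
  induction x using LocalizedModule.induction_on with | _ m s
  simp only [LinearMap.sub_apply, Module.End.mul_apply, LinearMap.neg_apply, ratPos_mk, ratZero_mk,
    loc_mk_sub_mk, ← polyAct_lie, lie_zero_pos]
  rw [← neg_one_smul ℂ, polyAct_smul, ← loc_smul_mk, neg_one_smul]

lemma ratZero_ratNeg : ratZero V * ratNeg V - ratNeg V * ratZero V = ratNeg V := by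
  ext x
  induction x using LocalizedModule.induction_on with | _ m s
  simp only [LinearMap.sub_apply, Module.End.mul_apply, ratNeg_mk, ratZero_mk,
    loc_mk_sub_mk, ← polyAct_lie, lie_zero_neg]

lemma ratNeg_ratPos : ratNeg V * ratPos V - ratPos V * ratNeg V = (-2 : ℂ) • ratZero V := by
  ext x
  induction x using LocalizedModule.induction_on with | _ m s
  have h : shiftDen (0 : ℂ) s = s := Subtype.ext (by simp [shiftDen, shift_apply])
  simp only [LinearMap.sub_apply, Module.End.mul_apply, LinearMap.smul_apply, ratPos_mk,
    ratZero_mk, ratNeg_mk, shiftDen_shiftDen, neg_add_cancel, add_neg_cancel, h,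
    loc_mk_sub_mk, ← polyAct_lie, lie_neg_pos, polyAct_smul, loc_smul_mk]

lemma triple_comm {A : Type u} [Ring A] [Algebra ℂ A] {P N Z : A} (h1 : Z * P - P * Z = -P)
    (h2 : Z * N - N * Z = N) (h3 : N * P - P * N = (-2 : ℂ) • Z) (a b c a' b' c' : ℂ) :
    (a • (-P) + b • N + c • ((-2 : ℂ) • Z)) * (a' • (-P) + b' • N + c' • ((-2 : ℂ) • Z)) -
      (a' • (-P) + b' • N + c' • ((-2 : ℂ) • Z)) * (a • (-P) + b • N + c • ((-2 : ℂ) • Z)) =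
    (2 * (c * a' - a * c')) • (-P) + (2 * (b * c' - c * b')) • N +
      (a * b' - b * a') • ((-2 : ℂ) • Z) := by
  rw [sub_eq_iff_eq_add] at h1 h2 h3
  simp only [mul_add, add_mul, smul_mul_assoc, mul_smul_comm, mul_neg, neg_mul]
  rw [h1, h2, h3]
  module

/-- The representation of `sl(2)` on `S⁻¹V` for which `L₋₁, L₀, L₁` act by the three operators
above. -/
def ratRep : sl2 →ₗ[ℂ] Module.End ℂ (RatSpace V) where
  toFun x := (x.1 0 1) • (-ratPos V) + (x.1 1 0) • ratNeg V + (x.1 0 0) • ((-2 : ℂ) • ratZero V)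
  map_add' x y := by
    change (x.1 0 1 + y.1 0 1) • (-ratPos V) + (x.1 1 0 + y.1 1 0) • ratNeg V +
      (x.1 0 0 + y.1 0 0) • ((-2 : ℂ) • ratZero V) = _
    module
  map_smul' c x := by
    change (c * x.1 0 1) • (-ratPos V) + (c * x.1 1 0) • ratNeg V +
      (c * x.1 0 0) • ((-2 : ℂ) • ratZero V) = c • _
    module

lemma ratRep_apply (x : sl2) : ratRep V x =
    (x.1 0 1) • (-ratPos V) + (x.1 1 0) • ratNeg V + (x.1 0 0) • ((-2 : ℂ) • ratZero V) := rfl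

lemma ratRep_lie (x y : sl2) :
    ratRep V ⁅x, y⁆ = ratRep V x * ratRep V y - ratRep V y * ratRep V x := by
  have h1 := lie_apply x y 0 1
  have h2 := lie_apply x y 1 0
  have h3 := lie_apply x y 0 0
  rw [Matrix.mul_apply, Matrix.mul_apply, Fin.sum_univ_two, Fin.sum_univ_two] at h1 h2 h3
  rw [sl2_apply_one_one, sl2_apply_one_one] at h1 h2
  replace h1 : (⁅x, y⁆ : sl2).1 0 1 = 2 * (x.1 0 0 * y.1 0 1 - x.1 0 1 * y.1 0 0) := by
    rw [h1]; ring
  replace h2 : (⁅x, y⁆ : sl2).1 1 0 = 2 * (x.1 1 0 * y.1 0 0 - x.1 0 0 * y.1 1 0) := by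
    rw [h2]; ring
  replace h3 : (⁅x, y⁆ : sl2).1 0 0 = x.1 0 1 * y.1 1 0 - x.1 1 0 * y.1 0 1 := by
    rw [h3]; ring
  rw [ratRep_apply, ratRep_apply, ratRep_apply,
    triple_comm (ratZero_ratPos V) (ratZero_ratNeg V) (ratNeg_ratPos V), h1, h2, h3]

lemma ratRep_pos : ratRep V Lpos = ratPos V := by
  rw [ratRep_apply]
  simp [Lpos, eElt, Matrix.single]

lemma ratRep_neg : ratRep V Lneg = ratNeg V := by
  rw [ratRep_apply]
  simp [Lneg, fElt, Matrix.single]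

lemma ratRep_zero : ratRep V Lzero = ratZero V := by
  rw [ratRep_apply]
  simp [Lzero, hElt, Matrix.single, smul_smul]

/-- The rationalization `F_rat(V)`, as an `sl(2)`-module structure on `S⁻¹V`. -/
instance ratLieRingModule : LieRingModule sl2 (RatSpace V) where
  bracket x w := ratRep V x w
  add_lie x y w := by
    change ratRep V (x + y) w = ratRep V x w + ratRep V y w
    rw [map_add, LinearMap.add_apply]
  lie_add x w w' := (ratRep V x).map_add w w'
  leibniz_lie x y w := by
    change ratRep V x (ratRep V y w) = ratRep V ⁅x, y⁆ w + ratRep V y (ratRep V x w)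
    rw [ratRep_lie]
    exact (sub_add_cancel _ _).symm

lemma rat_lie (x : sl2) (w : RatSpace V) : ⁅x, w⁆ = ratRep V x w := rfl

instance ratLieModule : LieModule ℂ sl2 (RatSpace V) where
  smul_lie c x w := by rw [rat_lie, rat_lie, map_smul, LinearMap.smul_apply]
  lie_smul c x w := (ratRep V x).map_smul c w

end Rationalization

/-! ### Functoriality on isomorphisms -/

section Functoriality

variable {V : Type u} [AddCommGroup V] [Module ℂ V] [LieRingModule sl2 V] [LieModule ℂ sl2 V]
variable {W : Type v} [AddCommGroup W] [Module ℂ W] [LieRingModule sl2 W] [LieModule ℂ sl2 W]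
variable {U : Type v} [AddCommGroup U] [Module ℂ U] [LieRingModule sl2 U] [LieModule ℂ sl2 U]

/-- An `sl(2)`-morphism as a map of `ℂ[z]`-modules. -/
def polyHom (φ : V →ₗ⁅ℂ, sl2⁆ W) : PolyMod V →ₗ[ℂ] PolyMod W :=
  (Module.AEval'.of (act W Lzero)).toLinearMap ∘ₗ (φ : V →ₗ[ℂ] W) ∘ₗ
    (Module.AEval'.of (act V Lzero)).symm.toLinearMap

lemma polyHom_of (φ : V →ₗ⁅ℂ, sl2⁆ W) (v : V) :
    polyHom φ (Module.AEval'.of (act V Lzero) v) = Module.AEval'.of (act W Lzero) (φ v) := rfl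

lemma polyHom_polyAct (φ : V →ₗ⁅ℂ, sl2⁆ W) (x : sl2) (m : PolyMod V) :
    polyHom φ (polyAct V x m) = polyAct W x (polyHom φ m) := by
  obtain ⟨v, rfl⟩ := (Module.AEval'.of (act V Lzero)).surjective m
  simp only [polyAct_of, polyHom_of, LieModuleHom.map_lie]

lemma polyHom_shiftLinear (φ : V →ₗ⁅ℂ, sl2⁆ W) : IsShiftLinear 0 (polyHom φ) := by
  apply isShiftLinear_of_X
  intro m
  obtain ⟨v, rfl⟩ := (Module.AEval'.of (act V Lzero)).surjective m
  rw [map_zero, add_zero, Module.AEval'.X_smul_of, polyHom_of, polyHom_of,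
    Module.AEval'.X_smul_of]
  exact congrArg _ (φ.map_lie Lzero v)

/-- The rationalization functor on morphisms: `v / p(z) ↦ φ(v) / p(z)`. -/
def ratHom (φ : V →ₗ⁅ℂ, sl2⁆ W) : RatSpace V →ₗ⁅ℂ, sl2⁆ RatSpace W where
  __ := locMap 0 (polyHom φ) (polyHom_shiftLinear φ)
  map_lie' {x w} := by
    change locMap 0 (polyHom φ) (polyHom_shiftLinear φ) ⁅x, w⁆ =
      ⁅x, locMap 0 (polyHom φ) (polyHom_shiftLinear φ) w⁆
    have key : ∀ (k : ℂ) (y : sl2) (hV : IsShiftLinear k (polyAct V y))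
        (hW : IsShiftLinear k (polyAct W y)) (w : RatSpace V),
        locMap 0 (polyHom φ) (polyHom_shiftLinear φ) (locMap k (polyAct V y) hV w) =
          locMap k (polyAct W y) hW (locMap 0 (polyHom φ) (polyHom_shiftLinear φ) w) := by
      intro k y hV hW w
      induction w using LocalizedModule.induction_on with | _ m s
      simp only [locMap_mk, shiftDen_shiftDen, polyHom_polyAct, add_comm]
    have hp := fun w => key 1 Lpos (shiftLinear_pos V) (shiftLinear_pos W) w
    have hz := fun w => key 0 Lzero (shiftLinear_zero V) (shiftLinear_zero W) w
    have hn := fun w => key (-1) Lneg (shiftLinear_neg V) (shiftLinear_neg W) w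
    rw [sl2_decomp x]
    simp only [add_lie, smul_lie, neg_lie, map_add, map_smul, map_neg, rat_lie, ratRep_pos,
      ratRep_neg, ratRep_zero]
    erw [hp, hz, hn]
    rfl

lemma ratHom_mk (φ : V →ₗ⁅ℂ, sl2⁆ W) (m : PolyMod V) (s : nonZeroDivisors ℂ[X]) :
    ratHom φ (LocalizedModule.mk m s) = LocalizedModule.mk (polyHom φ m) s := by
  have h : shiftDen (0 : ℂ) s = s := Subtype.ext (by simp [shiftDen, shift_apply])
  change LocalizedModule.mk (polyHom φ m) (shiftDen 0 s) = _
  rw [h]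

/-- The rationalization functor on isomorphisms. -/
def ratEquiv (φ : V ≃ₗ⁅ℂ, sl2⁆ W) : RatSpace V ≃ₗ⁅ℂ, sl2⁆ RatSpace W where
  __ := ratHom φ.toLieModuleHom
  invFun := ratHom φ.symm.toLieModuleHom
  left_inv x := by
    induction x using LocalizedModule.induction_on with | _ m s
    change ratHom φ.symm.toLieModuleHom (ratHom φ.toLieModuleHom _) = _
    rw [ratHom_mk, ratHom_mk]
    congr 1
    exact φ.symm_apply_apply m
  right_inv x := by
    induction x using LocalizedModule.induction_on with | _ m s
    change ratHom φ.toLieModuleHom (ratHom φ.symm.toLieModuleHom _) = _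
    rw [ratHom_mk, ratHom_mk]
    congr 1
    exact φ.apply_symm_apply m

end Functoriality

/-! ### Classes of modules and isomorphism classes -/

/-- A (bundled) `sl(2)`-module. -/
structure Sl2Mod : Type (u + 1) where
  carrier : Type u
  [addCommGroup : AddCommGroup carrier]
  [module : Module ℂ carrier]
  [lieRingModule : LieRingModule sl2 carrier]
  [lieModule : LieModule ℂ sl2 carrier]

attribute [instance] Sl2Mod.addCommGroup Sl2Mod.module Sl2Mod.lieRingModule Sl2Mod.lieModule

/-- The rationalization functor on objects. -/
def Sl2Mod.rat (V : Sl2Mod.{u}) : Sl2Mod.{u} := ⟨RatSpace V.carrier⟩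

/-- An `sl(2)`-submodule as an `sl(2)`-module. -/
def Sl2Mod.sub (V : Sl2Mod.{u}) (N : LieSubmodule ℂ sl2 V.carrier) : Sl2Mod.{u} := ⟨↥N⟩

/-- Torsion free modules (`sl(2)-Mod_tf`). -/
def TF (V : Sl2Mod.{u}) : Prop := IsTorsionFree V.carrier

/-- Torsion free modules of finite rank (`sl(2)-Mod_tffr`). -/
def TFFR (V : Sl2Mod.{u}) : Prop := IsTorsionFree V.carrier ∧ IsFiniteRank V.carrier

/-- Rational modules (`R`). -/
def Rational (V : Sl2Mod.{u}) : Prop := IsRational V.carrier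

/-- Rational Casimir modules (`RC`). -/
def RationalCasimir (V : Sl2Mod.{u}) : Prop := IsRational V.carrier ∧ IsCasimir V.carrier

/-- `Spl(A)`: the members of `A` that are simple as `sl(2)`-modules. -/
def Spl (A : Sl2Mod.{u} → Prop) (V : Sl2Mod.{u}) : Prop :=
  A V ∧ LieModule.IsIrreducible ℂ sl2 V.carrier

/-- `Spl_A(A)`: the nonzero members of `A` with no `sl(2)`-submodules belonging to `A`
other than `0` and the whole module. -/
def SplIn (A : Sl2Mod.{u} → Prop) (V : Sl2Mod.{u}) : Prop :=
  A V ∧ Nontrivial V.carrier ∧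
    ∀ N : LieSubmodule ℂ sl2 V.carrier, A (V.sub N) → N = ⊥ ∨ N = ⊤

/-- Isomorphism of `sl(2)`-modules. -/
instance isoSetoid : Setoid Sl2Mod.{u} where
  r V W := Nonempty (V.carrier ≃ₗ⁅ℂ, sl2⁆ W.carrier)
  iseqv :=
    ⟨fun _ => ⟨LieModuleEquiv.refl⟩, fun ⟨φ⟩ => ⟨φ.symm⟩, fun ⟨φ⟩ ⟨ψ⟩ => ⟨φ.trans ψ⟩⟩

/-- Isomorphism classes of `sl(2)`-modules. -/
def IsoClass : Type (u + 1) := Quotient isoSetoid.{u}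

/-- The set of isomorphism classes of the members of a class of modules. -/
def classes (P : Sl2Mod.{u} → Prop) : Set IsoClass.{u} :=
  {c | ∃ V : Sl2Mod.{u}, P V ∧ (Quotient.mk isoSetoid V : IsoClass.{u}) = c}

/-- The map induced by the rationalization functor on isomorphism classes. -/
def ratClass : IsoClass.{u} → IsoClass.{u} :=
  Quotient.map Sl2Mod.rat fun _ _ ⟨φ⟩ => ⟨ratEquiv φ⟩

end SlTwo

end

noncomputable section

open Polynomial

namespace SlTwo

/-! ### Shifts of polynomials -/

/-! `L₁` and `L₋₁` are semilinear over `ℂ[z]` for the shifts `z ↦ z ± 1`, and the Casimir operator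
is `ℂ[z]`-linear and central. On a Casimir module of level `μ`, the products `L₋₁L₁` and `L₁L₋₁` are
therefore multiplication by the nonzero polynomials `z(z-1) - μ` and `z(z+1) - μ`. A rational module
is the same as a torsion free, divisible module of finite rank (`isRational_iff`).

Simple modules are Casimir because their dimension is countable (`isCasimir_of_isIrreducible`). For
a simple torsion free module, semilinearity and the formula for `L₁L₋₁` show that, up to polynomial
multiples, a power of `L₁` carries any given vector into a fixed finitely generated submodule; hence
the rank is finite (`isFiniteRank_of_isIrreducible`).

A nonzero submodule of `S⁻¹V` meets `V`. If `V` is simple, such a submodule contains `V`, and if it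
is also divisible it is everything, so `F_rat(V)` is irreducible. Simple torsion free modules with
isomorphic rationalizations have images that meet inside one module, hence coincide.

For surjectivity, let `W` be an irreducible rational Casimir module. Saturations of submodules are
rational, so every nonzero submodule spans `W` over `ℂ(z)`. The denominators needed to move a fixed
lattice into such a submodule satisfy divisibility relations under both shifts, which bound them
uniformly (`exists_common_multiple`, `exists_uniform_multiple`). So the intersection of all nonzero
submodules is nonzero; it is simple and its rationalization is `W`.

Finally, on a rational module the Casimir operator is algebraic over `ℂ(z)` by Cayley–Hamilton.
Conjugating by `L₁` shifts the coefficients of an annihilating polynomial of least degree, so their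
ratios have period one and are constant. The Casimir operator is thus algebraic over `ℂ`, has an
eigenvalue, and is scalar if the module is irreducible (`isCasimir_of_isRational`). -/

lemma eval_shift (k c : ℂ) (p : ℂ[X]) : (shift k p).eval c = p.eval (c + k) := by
  rw [shift_apply, eval_comp]; simp

lemma shift_shift (k l : ℂ) (p : ℂ[X]) : shift k (shift l p) = shift (k + l) p := by
  rw [shift_apply, shift_apply, shift_apply, comp_assoc]
  congr 1
  simp [add_assoc]

lemma shift_zero (p : ℂ[X]) : shift 0 p = p := by simp [shift_apply]

lemma shift_ne_zero (k : ℂ) {p : ℂ[X]} (hp : p ≠ 0) : shift k p ≠ 0 := by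
  rw [← mem_nonZeroDivisors_iff_ne_zero] at hp ⊢
  exact shift_mem k hp

lemma shift_surjective (k : ℂ) : Function.Surjective (shift k) := fun p =>
  ⟨shift (-k) p, by rw [shift_shift, add_neg_cancel, shift_zero]⟩

/-- A polynomial is coprime to all sufficiently large shifts of another one. -/
lemma exists_isCoprime_shift {p q : ℂ[X]} (hp : p ≠ 0) (hq : q ≠ 0) :
    ∃ n₀ : ℕ, ∀ n : ℕ, n₀ ≤ n → IsCoprime p (shift n q) := by
  classical
  -- A common root `a` of `p` and `q(z + n)` exhibits `n = (a + n) - a` as a difference of a root of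
  -- `q` and a root of `p`; only finitely many `n` arise.
  let T : Finset ℂ := (q.roots.toFinset ×ˢ p.roots.toFinset).image fun x => x.1 - x.2
  have hfin : {n : ℕ | (n : ℂ) ∈ T}.Finite :=
    T.finite_toSet.preimage Nat.cast_injective.injOn
  obtain ⟨B, hB⟩ := hfin.bddAbove
  refine ⟨B + 1, fun n hn => ?_⟩
  rw [Polynomial.isCoprime_iff_aeval_ne_zero_of_isAlgClosed ℂ ℂ]
  intro a
  by_contra! h
  obtain ⟨h1, h2⟩ := h
  rw [coe_aeval_eq_eval] at h1 h2
  rw [eval_shift] at h2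
  have : n ∈ {n : ℕ | (n : ℂ) ∈ T} := by
    refine Finset.mem_image.2 ⟨(a + n, a), ?_, by simp⟩
    simp [hp, hq, h1, h2]
  have := hB this
  omega

/-- Iterate the divisibility, shifting it by `nε` at the `n`-th step. Once `q` is coprime to its own
`n`-th shift, only the product of shifts of `h` is left. -/
lemma dvd_shift_mul_prod {h q : ℂ[X]} {ε : ℂ} (hq : q ∣ shift ε q * h) (n : ℕ) :
    q ∣ shift (n * ε) q * ∏ i ∈ Finset.range n, shift (i * ε) h := by
  induction n with
  | zero => simp [shift_zero]
  | succ n ih =>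
    refine ih.trans ?_
    have := map_dvd (shift (n * ε)) hq
    rw [map_mul, shift_shift] at this
    rw [Finset.prod_range_succ_comm, ← mul_assoc]
    refine mul_dvd_mul ?_ dvd_rfl
    convert this using 3
    push_cast; ring_nf

/-- The polynomials that divide both `q(z+1) h(z)` and `q(z-1) h(z)` have a common multiple. -/
lemma exists_common_multiple {h : ℂ[X]} (hh : h ≠ 0) :
    ∃ P : ℂ[X], P ≠ 0 ∧
      ∀ q : ℂ[X], q ≠ 0 → q ∣ shift 1 q * h → q ∣ shift (-1) q * h → q ∣ P := by
  obtain ⟨n₀, hn₀⟩ := exists_isCoprime_shift hh hh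
  refine ⟨∏ i ∈ Finset.range n₀, shift (i * 1) h,
    Finset.prod_ne_zero_iff.2 fun i _ => shift_ne_zero _ hh, fun q hq h1 h2 => ?_⟩
  obtain ⟨n₁, hn₁⟩ := exists_isCoprime_shift hq hq
  set n := max n₀ n₁
  have hpos : q ∣ ∏ i ∈ Finset.range n, shift (i * 1) h := by
    refine IsCoprime.dvd_of_dvd_mul_left ?_ (dvd_shift_mul_prod h1 n)
    simpa using hn₁ n (le_max_right _ _)
  have hneg : q ∣ ∏ i ∈ Finset.range n, shift (i * (-1)) h := by
    refine IsCoprime.dvd_of_dvd_mul_left ?_ (dvd_shift_mul_prod h2 n)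
    have := (hn₁ n (le_max_right _ _)).symm.map (shift (n * (-1)))
    rw [shift_shift] at this
    simpa [shift_zero] using this
  -- By `hneg`, `q` is built from factors of the `h(z - j)`. Since `i ≥ n₀`, `h(z)` is coprime to
  -- `h(z + i + j)`, hence `h(z - j)` to `h(z + i)`. So only the factors with `i < n₀` matter, and
  -- this bound does not depend on `q`.
  have hcop : IsCoprime q (∏ i ∈ Finset.Ico n₀ n, shift (i * 1) h) := by
    refine IsCoprime.prod_right fun i hi => ?_
    refine IsCoprime.of_isCoprime_of_dvd_left (IsCoprime.prod_left fun j _ => ?_) hneg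
    have := (hn₀ (i + j) (by have := (Finset.mem_Ico.1 hi).1; omega)).map (shift (j * (-1)))
    rw [shift_shift] at this
    convert this using 2
    push_cast; ring_nf
  rw [← Finset.prod_range_mul_prod_Ico _ (le_max_left n₀ n₁)] at hpos
  exact hcop.dvd_of_dvd_mul_right hpos

/-- A rational function `p / q` of period one is constant. -/
lemma eq_C_mul_of_periodic {p q : ℂ[X]} (hq : q ≠ 0)
    (h : shift 1 p * q = p * shift 1 q) : ∃ t : ℂ, p = C t * q := by
  classical
  -- Start beyond the natural number roots of `q`, so that `p / q` is defined and constant along `c,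
  -- c + 1, c + 2, …`.
  obtain ⟨c, hc⟩ : ∃ c : ℕ, ∀ n : ℕ, q.eval ((c : ℂ) + n) ≠ 0 := by
    have hfin : {n : ℕ | (n : ℂ) ∈ q.roots.toFinset}.Finite :=
      q.roots.toFinset.finite_toSet.preimage Nat.cast_injective.injOn
    obtain ⟨B, hB⟩ := hfin.bddAbove
    refine ⟨B + 1, fun n hn => ?_⟩
    have : B + 1 + n ∈ {n : ℕ | (n : ℂ) ∈ q.roots.toFinset} := by
      simpa [hq] using hn
    have := hB this
    omega
  set t := p.eval (c : ℂ) / q.eval (c : ℂ)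
  have key : ∀ n : ℕ, p.eval ((c : ℂ) + n) = t * q.eval ((c : ℂ) + n) := by
    intro n
    induction n with
    | zero =>
      have := hc 0
      simp only [Nat.cast_zero, add_zero] at this ⊢
      simp only [t]; field_simp
    | succ n ih =>
      have := congrArg (eval ((c : ℂ) + n)) h
      rw [eval_mul, eval_mul, eval_shift, eval_shift, ih] at this
      push_cast
      rw [← add_assoc]
      apply mul_right_cancel₀ (hc n)
      rw [this]; ring
  refine ⟨t, eq_of_infinite_eval_eq _ _ ?_⟩
  refine Set.Infinite.mono (s := Set.range fun n : ℕ => (c : ℂ) + n) ?_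
    (Set.infinite_range_of_injective fun a b hab => by simpa using hab)
  rintro _ ⟨n, rfl⟩
  simpa using key n

/-- A torsion free and divisible `ℂ[z]`-module is a `ℂ(z)`-vector space. -/
lemma exists_module_ratFunc (M : Type u) [AddCommGroup M] [Module ℂ[X] M]
    [Module.IsTorsionFree ℂ[X] M] (hdiv : ∀ p : ℂ[X], p ≠ 0 → ∀ m : M, ∃ m', p • m' = m) :
    ∃ _ : Module (RatFunc ℂ) M, IsScalarTower ℂ[X] (RatFunc ℂ) M := by
  let ι := LocalizedModule.mkLinearMap (nonZeroDivisors ℂ[X]) M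
  -- Torsion freeness gives injectivity and divisibility gives surjectivity; the vector space
  -- structure is transported from the localization.
  have hι : Function.Bijective ι := by
    constructor
    · rw [← LinearMap.ker_eq_bot, LinearMap.ker_eq_bot']
      intro m hm
      obtain ⟨c, hc⟩ := (IsLocalizedModule.eq_zero_iff (nonZeroDivisors ℂ[X]) ι).1 hm
      exact (smul_eq_zero_iff_right (nonZeroDivisors.ne_zero c.2)).1 hc
    · intro x
      induction x using LocalizedModule.induction_on with | _ m s
      obtain ⟨m', rfl⟩ := hdiv s.1 (nonZeroDivisors.ne_zero s.2) m
      exact ⟨m', (LocalizedModule.mk_cancel s m').symm⟩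
  let e := LinearEquiv.ofBijective ι hι
  let _ : Module (RatFunc ℂ) (Loc M) :=
    LocalizedModule.moduleOfIsLocalization (S := nonZeroDivisors ℂ[X])
  let _ : Module (RatFunc ℂ) M := e.toAddEquiv.module (RatFunc ℂ)
  have hs : ∀ (c : RatFunc ℂ) (m : M), e (c • m) = c • e m := fun c m =>
    e.apply_symm_apply _
  exact ⟨inferInstance, ⟨fun p c m => e.injective (by rw [hs, map_smul, hs, smul_assoc])⟩⟩

/-! ### Modules and their associated `ℂ[z]`-modules -/

section PolyModule

variable (V : Type u) [AddCommGroup V] [Module ℂ V] [LieRingModule sl2 V] [LieModule ℂ sl2 V]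

/-- The identity map from `V` to its `ℂ[z]`-module. -/
abbrev toPoly : V ≃ₗ[ℂ] PolyMod V := Module.AEval'.of (act V Lzero)

lemma polyAct_zero (m : PolyMod V) : polyAct V Lzero m = (X : ℂ[X]) • m := by
  obtain ⟨v, rfl⟩ := (toPoly V).surjective m
  rw [polyAct_of, Module.AEval'.X_smul_of]
  rfl

lemma polyAct_pos_smul (p : ℂ[X]) (m : PolyMod V) :
    polyAct V Lpos (p • m) = shift 1 p • polyAct V Lpos m := shiftLinear_pos V p m

lemma polyAct_neg_smul (p : ℂ[X]) (m : PolyMod V) :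
    polyAct V Lneg (p • m) = shift (-1) p • polyAct V Lneg m := shiftLinear_neg V p m

lemma C_smul_polyMod (c : ℂ) (m : PolyMod V) : (C c : ℂ[X]) • m = c • m :=
  Module.AEval.C_smul _ c m

lemma polyAct_neg_pos_sub (m : PolyMod V) :
    polyAct V Lneg (polyAct V Lpos m) - polyAct V Lpos (polyAct V Lneg m) =
      (C (-2) * X : ℂ[X]) • m := by
  rw [← polyAct_lie, lie_neg_pos, polyAct_smul, polyAct_zero, mul_smul, C_smul_polyMod]

/-- The Casimir operator on the `ℂ[z]`-module. -/
def polyCas : PolyMod V →ₗ[ℂ[X]] PolyMod V where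
  toFun m := (X * (X - 1) : ℂ[X]) • m - polyAct V Lneg (polyAct V Lpos m)
  map_add' m m' := by simp only [smul_add, map_add]; abel
  map_smul' p m := by
    rw [polyAct_pos_smul, polyAct_neg_smul, shift_shift, neg_add_cancel, shift_zero, smul_sub,
      smul_comm, RingHom.id_apply]

lemma polyCas_apply (m : PolyMod V) :
    polyCas V m = (X * (X - 1) : ℂ[X]) • m - polyAct V Lneg (polyAct V Lpos m) := rfl

lemma polyCas_toPoly (v : V) : polyCas V (toPoly V v) = toPoly V (casimir V v) := by
  rw [polyCas_apply, ← Module.AEval.of_aeval_smul, polyAct_of, polyAct_of, ← map_sub]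
  congr 1
  simp [casimir]

lemma polyAct_neg_pos (m : PolyMod V) :
    polyAct V Lneg (polyAct V Lpos m) = (X * (X - 1) : ℂ[X]) • m - polyCas V m := by
  rw [polyCas_apply]; abel

lemma polyAct_pos_neg (m : PolyMod V) :
    polyAct V Lpos (polyAct V Lneg m) = (X * (X + 1) : ℂ[X]) • m - polyCas V m := by
  have h := polyAct_neg_pos_sub V m
  rw [polyAct_neg_pos] at h
  have h2 : polyAct V Lpos (polyAct V Lneg m) =
      (X * (X - 1) : ℂ[X]) • m - polyCas V m - (C (-2) * X : ℂ[X]) • m := by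
    rw [← h]; abel
  rw [h2, sub_right_comm, ← sub_smul]
  congr 2
  rw [map_neg, map_ofNat]; ring

/-- Compute `L₁L₋₁L₁ m` in two ways; the shift by one turns `z(z-1)` into `z(z+1)`. -/
lemma polyCas_pos (m : PolyMod V) :
    polyCas V (polyAct V Lpos m) = polyAct V Lpos (polyCas V m) := by
  have h := polyAct_pos_neg V (polyAct V Lpos m)
  rw [polyAct_neg_pos, map_sub, polyAct_pos_smul] at h
  have h2 : shift 1 (X * (X - 1)) = X * (X + 1) := by
    simp [shift_apply]; ring
  rw [h2] at h
  exact (sub_right_injective h).symm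

lemma polyCas_neg (m : PolyMod V) :
    polyCas V (polyAct V Lneg m) = polyAct V Lneg (polyCas V m) := by
  have h := polyAct_neg_pos V (polyAct V Lneg m)
  rw [polyAct_pos_neg, map_sub, polyAct_neg_smul] at h
  have h2 : shift (-1) (X * (X + 1)) = X * (X - 1) := by
    simp [shift_apply]; ring
  rw [h2] at h
  exact (sub_right_injective h).symm

lemma isCasimir_iff : IsCasimir V ↔ ∃ μ : ℂ, ∀ m : PolyMod V, polyCas V m = (C μ : ℂ[X]) • m := by
  refine exists_congr fun μ => ?_
  rw [LinearMap.ext_iff, (toPoly V).surjective.forall]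
  refine forall_congr' fun v => ?_
  rw [polyCas_toPoly, C_smul_polyMod, ← map_smul, (toPoly V).injective.eq_iff]
  rfl

variable {V}

/-- A `ℂ[z]`-submodule stable under `L₁` and `L₋₁` is an `sl(2)`-submodule. -/
def lieOfPoly (Q : Submodule ℂ[X] (PolyMod V)) (hP : ∀ m ∈ Q, polyAct V Lpos m ∈ Q)
    (hN : ∀ m ∈ Q, polyAct V Lneg m ∈ Q) : LieSubmodule ℂ sl2 V where
  __ := (Q.restrictScalars ℂ).comap (toPoly V).toLinearMap
  lie_mem {x v} hv := by
    change toPoly V ⁅x, v⁆ ∈ Q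
    replace hv : toPoly V v ∈ Q := hv
    rw [sl2_decomp x]
    simp only [add_lie, smul_lie, neg_lie, map_add, map_smul, map_neg, ← polyAct_of, polyAct_zero]
    exact add_mem (add_mem (Submodule.smul_of_tower_mem _ _ (neg_mem (hP _ hv)))
      (Submodule.smul_of_tower_mem _ _ (hN _ hv)))
      (Submodule.smul_of_tower_mem _ _ (Submodule.smul_of_tower_mem _ _ (Q.smul_mem _ hv)))

/-- An `sl(2)`-submodule as a `ℂ[z]`-submodule. -/
def polyOfLie (N : LieSubmodule ℂ sl2 V) : Submodule ℂ[X] (PolyMod V) :=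
  Module.AEval.mapSubmodule ℂ V (act V Lzero) ⟨N.toSubmodule, fun _ hv => N.lie_mem hv⟩

lemma mem_polyOfLie {N : LieSubmodule ℂ sl2 V} {v : V} : toPoly V v ∈ polyOfLie N ↔ v ∈ N :=
  Module.AEval.mem_mapSubmodule_apply _ _ _

lemma polyAct_mem_polyOfLie {N : LieSubmodule ℂ sl2 V} (x : sl2) {m : PolyMod V}
    (hm : m ∈ polyOfLie N) : polyAct V x m ∈ polyOfLie N := by
  obtain ⟨v, rfl⟩ := (toPoly V).surjective m
  rw [polyAct_of]
  exact mem_polyOfLie.2 (N.lie_mem (mem_polyOfLie.1 hm))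

section Hom

variable {W : Type v} [AddCommGroup W] [Module ℂ W] [LieRingModule sl2 W] [LieModule ℂ sl2 W]

lemma polyHom_smul (φ : V →ₗ⁅ℂ, sl2⁆ W) (p : ℂ[X]) (m : PolyMod V) :
    polyHom φ (p • m) = p • polyHom φ m := by
  rw [polyHom_shiftLinear φ p m, shift_zero]

/-- An `sl(2)`-morphism as a `ℂ[z]`-linear map. -/
def polyLin (φ : V →ₗ⁅ℂ, sl2⁆ W) : PolyMod V →ₗ[ℂ[X]] PolyMod W where
  toFun := polyHom φ
  map_add' := map_add _
  map_smul' := polyHom_smul φ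

lemma polyLin_toPoly (φ : V →ₗ⁅ℂ, sl2⁆ W) (v : V) :
    polyLin φ (toPoly V v) = toPoly W (φ v) := rfl

lemma polyLin_injective {φ : V →ₗ⁅ℂ, sl2⁆ W} (hφ : Function.Injective φ) :
    Function.Injective (polyLin φ) := hφ

lemma isTorsionFree_of_injective {φ : V →ₗ⁅ℂ, sl2⁆ W} (hφ : Function.Injective φ)
    (h : IsTorsionFree W) : IsTorsionFree V := by
  have : Module.IsTorsionFree ℂ[X] (PolyMod W) := h
  exact Function.Injective.moduleIsTorsionFree (polyLin φ) (polyLin_injective hφ)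
    fun c m => map_smul (polyLin φ) c m

lemma isCasimir_of_injective {φ : V →ₗ⁅ℂ, sl2⁆ W} (hφ : Function.Injective φ)
    (h : IsCasimir W) : IsCasimir V := by
  rw [isCasimir_iff] at h ⊢
  obtain ⟨μ, hμ⟩ := h
  refine ⟨μ, fun m => polyLin_injective hφ ?_⟩
  rw [map_smul, ← hμ, polyCas_apply, polyCas_apply, map_sub, map_smul]
  congr 1
  exact (polyHom_polyAct φ _ _).trans (congrArg _ (polyHom_polyAct φ _ _))

end Hom

lemma isFiniteRank_of_injective {W : Type u} [AddCommGroup W] [Module ℂ W] [LieRingModule sl2 W]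
    [LieModule ℂ sl2 W] {φ : V →ₗ⁅ℂ, sl2⁆ W} (hφ : Function.Injective φ)
    (h : IsFiniteRank W) : IsFiniteRank V :=
  (LinearMap.rank_le_of_injective (polyLin φ) (polyLin_injective hφ)).trans_lt h

variable (V)

/-- Rational means torsion free, divisible and of finite rank over `ℂ[z]`. -/
lemma isRational_iff : IsRational V ↔ IsTorsionFree V ∧
    (∀ p : ℂ[X], p ≠ 0 → ∀ m : PolyMod V, ∃ m', p • m' = m) ∧ IsFiniteRank V := by
  constructor
  · rintro ⟨_, _, _⟩
    have hinj : Function.Injective (algebraMap ℂ[X] (RatFunc ℂ)) := RatFunc.algebraMap_injective ℂ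
    refine ⟨?_, fun p hp m => ⟨(algebraMap ℂ[X] (RatFunc ℂ) p)⁻¹ • m, ?_⟩, ?_⟩
    · rw [IsTorsionFree, Module.isTorsionFree_iff_smul_eq_zero]
      intro p m h
      rw [← algebraMap_smul (RatFunc ℂ), smul_eq_zero, map_eq_zero_iff _ hinj] at h
      exact h
    · rw [← algebraMap_smul (RatFunc ℂ) p, smul_inv_smul₀]
      rwa [Ne, map_eq_zero_iff _ hinj]
    · rw [IsFiniteRank, ← IsFractionRing.rank_right_eq ℂ[X] (RatFunc ℂ)]
      exact Module.rank_lt_aleph0 _ _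
  · rintro ⟨htf, hdiv, hfin⟩
    have : Module.IsTorsionFree ℂ[X] (PolyMod V) := htf
    obtain ⟨_, hst⟩ := exists_module_ratFunc (PolyMod V) hdiv
    refine ⟨inferInstance, hst, ?_⟩
    rw [← Module.rank_lt_aleph0_iff, IsFractionRing.rank_right_eq ℂ[X] (RatFunc ℂ)]
    exact hfin

end PolyModule

/-! ### Simple modules are Casimir -/

/-- For nonconstant `p`, spectral mapping makes the spectrum of `p(a)` empty as well, so it omits
`0`. -/
lemma isUnit_aeval_of_spectrum_eq_empty {A : Type*} [Ring A] [Algebra ℂ A] {a : A}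
    (ha : spectrum ℂ a = ∅) {p : ℂ[X]} (hp : p ≠ 0) : IsUnit (aeval a p) := by
  by_cases hd : 0 < p.degree
  · have h := spectrum.map_polynomial_aeval_of_degree_pos a p hd
    rw [ha, Set.image_empty] at h
    exact spectrum.zero_notMem_iff ℂ |>.1 (h ▸ Set.notMem_empty _)
  · rw [eq_C_of_degree_le_zero (not_lt.1 hd)] at hp ⊢
    rw [aeval_C]
    exact (IsUnit.mk0 _ (by simpa using hp)).map _

section CasimirOperator

variable (V : Type u) [AddCommGroup V] [Module ℂ V] [LieRingModule sl2 V] [LieModule ℂ sl2 V]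

lemma casimir_lie (x : sl2) (v : V) : casimir V ⁅x, v⁆ = ⁅x, casimir V v⁆ := by
  have key : ∀ y : sl2, (∀ m, polyCas V (polyAct V y m) = polyAct V y (polyCas V m)) →
      casimir V ⁅y, v⁆ = ⁅y, casimir V v⁆ := fun y hy => by
    apply (toPoly V).injective
    rw [← polyCas_toPoly, ← polyAct_of, hy, polyCas_toPoly, polyAct_of]
  have h1 := key Lpos (polyCas_pos V)
  have h2 := key Lneg (polyCas_neg V)
  have h3 := key Lzero fun m => by rw [polyAct_zero, polyAct_zero, map_smul]
  rw [sl2_decomp x]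
  simp only [add_lie, smul_lie, neg_lie, map_add, map_smul, map_neg, h1, h2, h3]

/-- The operator `C - μ` as an `sl(2)`-morphism. -/
def casimirSub (μ : ℂ) : V →ₗ⁅ℂ, sl2⁆ V where
  __ := algebraMap ℂ (Module.End ℂ V) μ - casimir V
  map_lie' {x v} := by
    change μ • ⁅x, v⁆ - casimir V ⁅x, v⁆ = ⁅x, μ • v - casimir V v⁆
    rw [casimir_lie, lie_sub, lie_smul]

variable {V} in
lemma isCasimir_of_casimirSub_eq_zero {μ : ℂ} (h : ∀ v, casimirSub V μ v = 0) : IsCasimir V :=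
  ⟨μ, LinearMap.ext fun v => (sub_eq_zero.1 (h v)).symm⟩

/-- Schur's lemma in a form that serves both simplicity and irreducibility among rational modules:
all that is needed is that kernels and ranges of `C - μ` are trivial or everything. -/
lemma isCasimir_of_spectrum_nonempty (h : (spectrum ℂ (casimir V)).Nonempty)
    (hker : ∀ μ, (casimirSub V μ).ker = ⊥ ∨ (casimirSub V μ).ker = ⊤)
    (hrange : ∀ μ, (casimirSub V μ).range = ⊥ ∨ (casimirSub V μ).range = ⊤) :
    IsCasimir V := by
  obtain ⟨μ, hμ⟩ := h
  rw [spectrum.mem_iff, Module.End.isUnit_iff] at hμ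
  by_cases hk : (casimirSub V μ).ker = ⊥
  · by_cases hr : (casimirSub V μ).range = ⊤
    · exact absurd ⟨(LieModuleHom.ker_eq_bot _).1 hk, (LieModuleHom.range_eq_top _).1 hr⟩ hμ
    · have := (hrange μ).resolve_right hr
      refine isCasimir_of_casimirSub_eq_zero (μ := μ) fun v => ?_
      rw [← LieSubmodule.mem_bot (R := ℂ) (L := sl2), ← this]
      exact (LieModuleHom.mem_range _ _).2 ⟨v, rfl⟩
  · have := (hker μ).resolve_left hk
    refine isCasimir_of_casimirSub_eq_zero (μ := μ) fun v => ?_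
    rw [← LieModuleHom.mem_ker, this]
    exact LieSubmodule.mem_top _

/-- The countably many words in `L₁, L₋₁, L₀`, applied to one nonzero vector, span a submodule. -/
lemma rank_le_aleph0_of_isIrreducible [LieModule.IsIrreducible ℂ sl2 V] :
    Module.rank ℂ V ≤ Cardinal.aleph0 := by
  have : Nontrivial V := (LieSubmodule.nontrivial_iff ℂ sl2 V).1 inferInstance
  obtain ⟨v, hv⟩ := exists_ne (0 : V)
  let g : Fin 3 → sl2 := ![Lpos, Lneg, Lzero]
  let w : List (Fin 3) → V := fun l => l.foldr (fun i u => ⁅g i, u⁆) v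
  have hg : ∀ i, ∀ u ∈ Submodule.span ℂ (Set.range w),
      ⁅g i, u⁆ ∈ Submodule.span ℂ (Set.range w) := by
    intro i u hu
    induction hu using Submodule.span_induction with
    | mem u hu =>
      obtain ⟨l, rfl⟩ := hu
      exact Submodule.subset_span ⟨i :: l, rfl⟩
    | zero => rw [lie_zero]; exact zero_mem _
    | add a b _ _ ha hb => rw [lie_add]; exact add_mem ha hb
    | smul c a _ ha => rw [lie_smul]; exact Submodule.smul_mem _ _ ha
  let N : LieSubmodule ℂ sl2 V :=
    { Submodule.span ℂ (Set.range w) with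
      lie_mem := by
        intro x u hu
        change ⁅x, u⁆ ∈ Submodule.span ℂ (Set.range w)
        rw [sl2_decomp x]
        simp only [add_lie, smul_lie, neg_lie]
        exact add_mem (add_mem (Submodule.smul_mem _ _ (neg_mem (hg 0 u hu)))
          (Submodule.smul_mem _ _ (hg 1 u hu)))
          (Submodule.smul_mem _ _ (Submodule.smul_mem _ _ (hg 2 u hu))) }
  have hvN : v ∈ N := Submodule.subset_span ⟨[], rfl⟩
  have hN : N = ⊤ := (eq_bot_or_eq_top N).resolve_left fun h => hv (by
    rwa [h, LieSubmodule.mem_bot] at hvN)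
  have htop : Submodule.span ℂ (Set.range w) = ⊤ :=
    eq_top_iff.2 fun u _ => (hN ▸ LieSubmodule.mem_top u : u ∈ N)
  rw [← rank_top, ← htop]
  exact (rank_span_le _).trans (Set.countable_range w).le_aleph0

/-- The Casimir operator of a simple module is a scalar. -/
lemma isCasimir_of_isIrreducible [LieModule.IsIrreducible ℂ sl2 V] : IsCasimir V := by
  refine isCasimir_of_spectrum_nonempty V (Set.nonempty_iff_ne_empty.2 fun hspec => ?_)
    (fun _ => eq_bot_or_eq_top _) (fun _ => eq_bot_or_eq_top _)
  have : Nontrivial V := (LieSubmodule.nontrivial_iff ℂ sl2 V).1 inferInstance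
  have hbij : ∀ p : ℂ[X], p ≠ 0 → Function.Bijective (aeval (casimir V) p) := fun p hp =>
    (Module.End.isUnit_iff _).1 (isUnit_aeval_of_spectrum_eq_empty hspec hp)
  -- Here the variable acts by the Casimir operator, not by `L₀`: empty spectrum makes `V` a vector
  -- space over the field of rational functions in `C`.
  let M := Module.AEval' (casimir V)
  have htf : Module.IsTorsionFree ℂ[X] M := by
    rw [Module.isTorsionFree_iff_smul_eq_zero]
    intro p m h
    by_contra! hpm
    exact hpm.2 ((map_eq_zero_iff _ (hbij p hpm.1).1).1 h)
  obtain ⟨_, _⟩ := exists_module_ratFunc M fun p hp m => (hbij p hp).2 m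
  have htower : IsScalarTower ℂ (RatFunc ℂ) M := ⟨fun c k m => by
    rw [← algebraMap_smul ℂ[X] c k, smul_assoc, algebraMap_smul]⟩
  obtain ⟨v, hv⟩ : ∃ v : M, v ≠ 0 := exists_ne (0 : V)
  let f : RatFunc ℂ →ₗ[ℂ] M :=
    (LinearMap.toSpanSingleton (RatFunc ℂ) M v).restrictScalars ℂ
  have hf : Function.Injective f := fun a b hab => 
    smul_left_injective (RatFunc ℂ) (M := M) hv hab
  -- The functions `1/(t - c)`, `c ∈ ℂ`, are linearly independent, so `V` would have dimension at
  -- least the continuum.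
  have h1 := (RatFunc.transcendental_X (K := ℂ)).linearIndependent_sub_inv.map' f
    (LinearMap.ker_eq_bot.2 hf)
  have h2 := h1.cardinal_lift_le_rank
  have h3 : Module.rank ℂ M ≤ Cardinal.aleph0 := rank_le_aleph0_of_isIrreducible V
  have h4 := h2.trans (Cardinal.lift_le.2 h3)
  simp only [Cardinal.mk_complex, Cardinal.lift_continuum, Cardinal.lift_aleph0] at h4
  exact absurd h4 (not_le.2 Cardinal.aleph0_lt_continuum)

end CasimirOperator

/-! ### Simple torsion free modules have finite rank -/

section FiniteRank

variable {V : Type u} [AddCommGroup V] [Module ℂ V] [LieRingModule sl2 V] [LieModule ℂ sl2 V]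

lemma smul_eq_zero_of_isTorsionFree (hV : IsTorsionFree V) {p : ℂ[X]} {m : PolyMod V}
    (h : p • m = 0) : p = 0 ∨ m = 0 := by
  have : Module.IsTorsionFree ℂ[X] (PolyMod V) := hV
  exact smul_eq_zero.1 h

lemma X_mul_X_sub_sub_ne_zero (a μ : ℂ) : (X * (X + C a) - C μ : ℂ[X]) ≠ 0 := by
  intro h
  have h2 := congrArg natDegree h
  have h3 : (X * (X + C a) - C μ : ℂ[X]).natDegree = 2 := by compute_degree!
  rw [h3, natDegree_zero] at h2
  exact two_ne_zero h2

lemma polyAct_neg_pos_of_casimir {μ : ℂ} (hμ : ∀ m : PolyMod V, polyCas V m = (C μ : ℂ[X]) • m)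
    (m : PolyMod V) :
    polyAct V Lneg (polyAct V Lpos m) = (X * (X + C (-1)) - C μ : ℂ[X]) • m := by
  rw [polyAct_neg_pos, hμ, ← sub_smul, map_neg, map_one, sub_eq_add_neg X 1]

lemma polyAct_pos_neg_of_casimir {μ : ℂ} (hμ : ∀ m : PolyMod V, polyCas V m = (C μ : ℂ[X]) • m)
    (m : PolyMod V) :
    polyAct V Lpos (polyAct V Lneg m) = (X * (X + C 1) - C μ : ℂ[X]) • m := by
  rw [polyAct_pos_neg, hμ, ← sub_smul, map_one]

/-- `L₋₁L₁` is multiplication by a nonzero polynomial on a torsion free module. -/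
lemma polyAct_pos_injective (hV : IsTorsionFree V) (hC : IsCasimir V) :
    Function.Injective (polyAct V Lpos) := by
  obtain ⟨μ, hμ⟩ := (isCasimir_iff V).1 hC
  rw [injective_iff_map_eq_zero]
  intro m hm
  have h := polyAct_neg_pos_of_casimir hμ m
  rw [hm, map_zero] at h
  exact (smul_eq_zero_of_isTorsionFree hV h.symm).resolve_left (X_mul_X_sub_sub_ne_zero _ _)

lemma polyAct_pos_pow_smul (k : ℕ) (p : ℂ[X]) (m : PolyMod V) :
    (polyAct V Lpos ^ k) (p • m) = shift k p • (polyAct V Lpos ^ k) m := by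
  induction k with
  | zero => simp [shift_zero]
  | succ k ih =>
    rw [pow_succ', Module.End.mul_apply, ih, polyAct_pos_smul, shift_shift, Module.End.mul_apply]
    push_cast
    rw [add_comm]

/-- The elements some multiple of whose image under some power of `L₁` lies in `Q`. -/
def EventuallyIn (Q : Submodule ℂ[X] (PolyMod V)) (k : ℕ) (m : PolyMod V) : Prop :=
  ∃ p : ℂ[X], p ≠ 0 ∧ p • (polyAct V Lpos ^ k) m ∈ Q

lemma EventuallyIn.mono {Q : Submodule ℂ[X] (PolyMod V)}
    (hQ : ∀ q ∈ Q, ∃ p : ℂ[X], p ≠ 0 ∧ p • polyAct V Lpos q ∈ Q) {k l : ℕ} (hkl : k ≤ l)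
    {m : PolyMod V} (h : EventuallyIn Q k m) : EventuallyIn Q l m := by
  induction l, hkl using Nat.le_induction with
  | base => exact h
  | succ l _ ih =>
    obtain ⟨p, hp, hpm⟩ := ih
    obtain ⟨p', hp', hpm'⟩ := hQ _ hpm
    refine ⟨p' * shift 1 p, mul_ne_zero hp' (shift_ne_zero _ hp), ?_⟩
    rwa [pow_succ', Module.End.mul_apply, mul_smul, ← polyAct_pos_smul]

/-- The elements with a nonzero multiple whose image under some power of `L₁` lies in `Q` form an
`sl(2)`-submodule. -/
def eventualLie (Q : Submodule ℂ[X] (PolyMod V))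
    (hQ : ∀ q ∈ Q, ∃ p : ℂ[X], p ≠ 0 ∧ p • polyAct V Lpos q ∈ Q) (hC : IsCasimir V) :
    LieSubmodule ℂ sl2 V :=
  lieOfPoly
    { carrier := {m | ∃ k, EventuallyIn Q k m}
      add_mem' := by
        rintro a b ⟨k, ha⟩ ⟨l, hb⟩
        obtain ⟨p, hp, hpa⟩ := ha.mono hQ (le_max_left k l)
        obtain ⟨q, hq, hqb⟩ := hb.mono hQ (le_max_right k l)
        refine ⟨max k l, p * q, mul_ne_zero hp hq, ?_⟩
        rw [map_add, smul_add]
        refine add_mem ?_ ?_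
        · rw [mul_comm, mul_smul]; exact Q.smul_mem _ hpa
        · rw [mul_smul]; exact Q.smul_mem _ hqb
      zero_mem' := ⟨0, 1, one_ne_zero, by simp⟩
      smul_mem' := by
        rintro r m ⟨k, p, hp, hpm⟩
        refine ⟨k, p, hp, ?_⟩
        rw [polyAct_pos_pow_smul, smul_comm]
        exact Q.smul_mem _ hpm }
    (by
      rintro m ⟨k, h⟩
      obtain ⟨p, hp, hpm⟩ := h.mono hQ k.le_succ
      refine ⟨k, p, hp, ?_⟩
      rwa [pow_succ, Module.End.mul_apply] at hpm)
    (by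
      rintro m ⟨k, p, hp, hpm⟩
      obtain ⟨μ, hμ⟩ := (isCasimir_iff V).1 hC
      refine ⟨k + 1, p, hp, ?_⟩
      -- `L₁^(k+1) L₋₁ m = L₁^k (L₁L₋₁ m)` is a polynomial multiple of `L₁^k m`; hence the exponent
      -- `k + 1`.
      rw [pow_succ, Module.End.mul_apply, polyAct_pos_neg_of_casimir hμ, polyAct_pos_pow_smul,
        smul_comm]
      exact Q.smul_mem _ hpm)

lemma mem_eventualLie {Q : Submodule ℂ[X] (PolyMod V)}
    {hQ : ∀ q ∈ Q, ∃ p : ℂ[X], p ≠ 0 ∧ p • polyAct V Lpos q ∈ Q} {hC : IsCasimir V} {v : V} :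
    v ∈ eventualLie Q hQ hC ↔ ∃ k, EventuallyIn Q k (toPoly V v) := Iff.rfl

/-- `eventualLie` is a submodule, so by simplicity one nonzero element in it suffices to capture
every vector. -/
lemma eventuallyIn_of_mem [LieModule.IsIrreducible ℂ sl2 V] (hC : IsCasimir V)
    {Q : Submodule ℂ[X] (PolyMod V)}
    (hQ : ∀ q ∈ Q, ∃ p : ℂ[X], p ≠ 0 ∧ p • polyAct V Lpos q ∈ Q) {m : PolyMod V} (hm : m ≠ 0)
    {k : ℕ} (hk : EventuallyIn Q k m) (m' : PolyMod V) : ∃ k, EventuallyIn Q k m' := by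
  have h : eventualLie Q hQ hC = ⊤ := by
    refine (eq_bot_or_eq_top _).resolve_left fun h => hm ?_
    have : (toPoly V).symm m ∈ eventualLie Q hQ hC := mem_eventualLie.2 ⟨k, hk⟩
    rw [h, LieSubmodule.mem_bot] at this
    exact this
  have : (toPoly V).symm m' ∈ eventualLie Q hQ hC := h ▸ LieSubmodule.mem_top _
  exact mem_eventualLie.1 this

/-- In a simple torsion free module the iterates of `L₁` on a vector are linearly dependent. -/
lemma not_linearIndependent_pow [LieModule.IsIrreducible ℂ sl2 V] (hC : IsCasimir V)
    (v : PolyMod V) : ¬ LinearIndependent ℂ[X] fun i : ℕ => (polyAct V Lpos ^ i) v := by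
  intro hli
  set b : ℕ → PolyMod V := fun i => (polyAct V Lpos ^ i) v with hb
  have hPb : ∀ i, polyAct V Lpos (b i) = b (i + 1) := fun i => by
    simp only [hb, pow_succ', Module.End.mul_apply]
  -- `Q` is `L₁`-stable and nonzero, yet combinations of the `b i` lying in it have coefficient sum
  -- zero (the functional `φ`). A nonzero multiple `p • b k` of a single vector has coefficient sum
  -- `p`, so it cannot lie in `Q`.
  let Q : Submodule ℂ[X] (PolyMod V) := Submodule.span ℂ[X] (Set.range fun i => b i - b (i + 1))
  have hQ : ∀ q ∈ Q, polyAct V Lpos q ∈ Q := by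
    intro q hq
    induction hq using Submodule.span_induction with
    | mem q hq =>
      obtain ⟨i, rfl⟩ := hq
      refine Submodule.subset_span ⟨i + 1, ?_⟩
      simp only [map_sub, hPb]
    | zero => rw [map_zero]; exact zero_mem _
    | add x y _ _ hx hy => rw [map_add]; exact add_mem hx hy
    | smul r x _ hx => rw [polyAct_pos_smul]; exact Q.smul_mem _ hx
  have hne : b 0 - b 1 ≠ 0 := fun h => zero_ne_one (hli.injective (sub_eq_zero.1 h))
  obtain ⟨k, p, hp, hpk⟩ := eventuallyIn_of_mem hC
    (fun q hq => ⟨1, one_ne_zero, by rw [one_smul]; exact hQ q hq⟩) hne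
    (k := 0) ⟨1, one_ne_zero, by rw [one_smul]; exact Submodule.subset_span ⟨0, rfl⟩⟩ v
  let φ : (ℕ →₀ ℂ[X]) →ₗ[ℂ[X]] ℂ[X] := Finsupp.linearCombination ℂ[X] fun _ => (1 : ℂ[X])
  have hle : Q ≤ (LinearMap.ker φ).map (Finsupp.linearCombination ℂ[X] b) := by
    refine Submodule.span_le.2 ?_
    rintro _ ⟨i, rfl⟩
    refine ⟨Finsupp.single i 1 - Finsupp.single (i + 1) 1, ?_, ?_⟩
    · simp [φ]
    · simp
  obtain ⟨g, hg, hgp⟩ := hle hpk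
  have : g = Finsupp.single k p := hli (by rw [hgp, Finsupp.linearCombination_single])
  rw [this] at hg
  exact hp (by simpa [φ] using hg)

lemma linearIndependent_smul_of_ne_zero {ι : Type*} {x : ι → PolyMod V}
    (hx : LinearIndependent ℂ[X] x) {p : ι → ℂ[X]} (hp : ∀ i, p i ≠ 0) :
    LinearIndependent ℂ[X] fun i => p i • x i := by
  rw [linearIndependent_iff'] at hx ⊢
  intro s g hg i hi
  have := hx s (fun i => g i * p i) (by simpa only [mul_smul] using hg) i hi
  exact (mul_eq_zero.1 this).resolve_right (hp i)

/-- Simple torsion free modules have finite rank. -/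
lemma isFiniteRank_of_isIrreducible [LieModule.IsIrreducible ℂ sl2 V] (hV : IsTorsionFree V) :
    IsFiniteRank V := by
  have hC := isCasimir_of_isIrreducible V
  have hinj := polyAct_pos_injective hV hC
  have : Nontrivial V := (LieSubmodule.nontrivial_iff ℂ sl2 V).1 inferInstance
  obtain ⟨v, hv⟩ : ∃ v : PolyMod V, v ≠ 0 := exists_ne (0 : V)
  have hdep := not_linearIndependent_pow hC v
  set b : ℕ → PolyMod V := fun i => (polyAct V Lpos ^ i) v with hb
  have hPb : ∀ i, polyAct V Lpos (b i) = b (i + 1) := fun i => by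
    simp only [hb, pow_succ', Module.End.mul_apply]
  rw [linearIndependent_iff] at hdep
  push Not at hdep
  obtain ⟨g, hg, hg0⟩ := hdep
  have hsupp : g.support.Nonempty := Finsupp.support_nonempty_iff.2 hg0
  set n := g.support.max' hsupp
  have hgn : g n ≠ 0 := Finsupp.mem_support_iff.1 (g.support.max'_mem hsupp)
  -- The relation with top index `n` puts `g n • b n` into this span, so `L₁` preserves `Q` up to
  -- the single multiplier `g n`.
  let Q : Submodule ℂ[X] (PolyMod V) := Submodule.span ℂ[X] (b '' Set.Iio n)
  have hbn : g n • b n ∈ Q := by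
    rw [Finsupp.linearCombination_apply, Finsupp.sum,
      ← Finset.add_sum_erase _ _ (g.support.max'_mem hsupp)] at hg
    rw [eq_neg_of_add_eq_zero_left hg]
    refine neg_mem (sum_mem fun i hi => Q.smul_mem _ (Submodule.subset_span ⟨i, ?_, rfl⟩))
    exact lt_of_le_of_ne (g.support.le_max' i (Finset.mem_of_mem_erase hi))
      (Finset.ne_of_mem_erase hi)
  have hQ : ∀ q ∈ Q, g n • polyAct V Lpos q ∈ Q := by
    intro q hq
    induction hq using Submodule.span_induction with
    | mem q hq =>
      obtain ⟨i, hi, rfl⟩ := hq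
      rw [hPb]
      rcases (Nat.succ_le_of_lt hi).lt_or_eq with h | h
      · exact Q.smul_mem _ (Submodule.subset_span ⟨i + 1, h, rfl⟩)
      · rw [← Nat.succ_eq_add_one, h]; exact hbn
    | zero => rw [map_zero, smul_zero]; exact zero_mem _
    | add x y _ _ hx hy => rw [map_add, smul_add]; exact add_mem hx hy
    | smul r x _ hx => rw [polyAct_pos_smul, smul_comm]; exact Q.smul_mem _ hx
  have hQ' : ∀ q ∈ Q, ∃ p : ℂ[X], p ≠ 0 ∧ p • polyAct V Lpos q ∈ Q :=
    fun q hq => ⟨g n, hgn, hQ q hq⟩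
  have hall := eventuallyIn_of_mem hC hQ' hv (k := n) ⟨g n, hgn, hbn⟩
  have hfinQ : Module.Finite ℂ[X] Q := by
    rw [Module.Finite.iff_fg]
    exact Submodule.fg_span ((Set.finite_Iio n).image b)
  have hrank : Module.rank ℂ[X] (PolyMod V) ≤ Module.finrank ℂ[X] Q := by
    refine rank_le fun s hs => ?_
    choose k hk using hall
    have hK : ∀ m : s, EventuallyIn Q (s.sup k) m := fun m =>
      (hk m).mono hQ' (Finset.le_sup m.2)
    choose p hp hpm using hK
    -- A common power of `L₁` is injective and semilinear along an automorphism, so it preserves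
    -- independence; nonzero multiples then land in `Q`, whose rank bounds the size of `s`.
    have h1 : LinearIndependent ℂ[X] fun m : s => (polyAct V Lpos ^ s.sup k) (m : PolyMod V) :=
      hs.map_of_surjective_injective (shift (s.sup k : ℕ))
        (polyAct V Lpos ^ s.sup k).toAddMonoidHom (shift_surjective _)
        ((injective_iff_map_eq_zero (polyAct V Lpos ^ s.sup k)).1 (by
          rw [Module.End.coe_pow]; exact hinj.iterate _))
        fun r m => polyAct_pos_pow_smul _ r m
    have h2 := linearIndependent_smul_of_ne_zero h1 hp
    have h3 : LinearIndependent ℂ[X] fun m : s => (⟨_, hpm m⟩ : Q) :=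
      LinearIndependent.of_comp Q.subtype h2
    simpa using h3.fintype_card_le_finrank
  exact hrank.trans_lt (Cardinal.natCast_lt_aleph0)

end FiniteRank

/-! ### The rationalization of a module -/

/-- A bijective morphism is an isomorphism. -/
def lieEquivOfBijective {V : Type u} [AddCommGroup V] [Module ℂ V] [LieRingModule sl2 V]
    {W : Type v} [AddCommGroup W] [Module ℂ W] [LieRingModule sl2 W]
    (φ : V →ₗ⁅ℂ, sl2⁆ W) (h : Function.Bijective φ) : V ≃ₗ⁅ℂ, sl2⁆ W where
  __ := φ
  invFun := (Equiv.ofBijective φ h).symm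
  left_inv := (Equiv.ofBijective φ h).symm_apply_apply
  right_inv := (Equiv.ofBijective φ h).apply_symm_apply

/-- The preimage of `N` is a nonzero submodule of a simple module. -/
lemma map_mem_of_isIrreducible {V : Type u} [AddCommGroup V] [Module ℂ V] [LieRingModule sl2 V]
    [LieModule.IsIrreducible ℂ sl2 V] {W : Type v} [AddCommGroup W] [Module ℂ W]
    [LieRingModule sl2 W] [LieModule ℂ sl2 W] (φ : V →ₗ⁅ℂ, sl2⁆ W)
    {N : LieSubmodule ℂ sl2 W} {v : V} (hv : v ≠ 0) (hvN : φ v ∈ N) (v' : V) : φ v' ∈ N := by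
  have h : N.comap φ = ⊤ := (eq_bot_or_eq_top _).resolve_left fun h => hv (by
    have : v ∈ N.comap φ := hvN
    rwa [h, LieSubmodule.mem_bot] at this)
  have : v' ∈ N.comap φ := h ▸ LieSubmodule.mem_top _
  exact this

section RatProperties

variable (V : Type u) [AddCommGroup V] [Module ℂ V] [LieRingModule sl2 V] [LieModule ℂ sl2 V]

lemma ratZero_eq_smul (w : RatSpace V) : ratZero V w = (X : ℂ[X]) • w := by
  induction w using LocalizedModule.induction_on with | _ m s
  rw [ratZero_mk, polyAct_zero, LocalizedModule.smul'_mk]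

/-- On `S⁻¹V` the variable acts by `L₀`. -/
def polyRatEquiv : PolyMod (RatSpace V) ≃ₗ[ℂ[X]] RatSpace V :=
  LinearEquiv.ofAEval _ (LinearEquiv.refl ℂ _) fun w => by
    change ratRep V Lzero w = _
    rw [ratRep_zero, ratZero_eq_smul]
    rfl

lemma polyRatEquiv_toPoly (w : RatSpace V) : polyRatEquiv V (toPoly _ w) = w := rfl

lemma isTorsionFree_ratSpace : IsTorsionFree (RatSpace V) := by
  rw [IsTorsionFree, Module.isTorsionFree_iff_smul_eq_zero]
  intro p w h
  by_contra! hpw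
  refine hpw.2 ((map_eq_zero_iff _ (polyRatEquiv V).injective).1 ?_)
  refine LocalizedModule.eq_zero_of_smul_eq_zero (S := nonZeroDivisors ℂ[X]) p
    (mem_nonZeroDivisors_iff_ne_zero.2 hpw.1) _ ?_
  rw [← map_smul, h, map_zero]

/-- Localization makes the module divisible and torsion free without changing the rank. -/
lemma isRational_ratSpace (hV : IsFiniteRank V) : IsRational (RatSpace V) := by
  rw [isRational_iff]
  refine ⟨isTorsionFree_ratSpace V, fun p hp w => ?_, ?_⟩
  · obtain ⟨w, rfl⟩ := (polyRatEquiv V).symm.surjective w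
    induction w using LocalizedModule.induction_on with | _ m s
    let p' : nonZeroDivisors ℂ[X] := ⟨p, mem_nonZeroDivisors_iff_ne_zero.2 hp⟩
    refine ⟨(polyRatEquiv V).symm (LocalizedModule.mk m (p' * s)), ?_⟩
    rw [← map_smul, LocalizedModule.smul'_mk]
    exact congrArg _ (LocalizedModule.mk_cancel_common_left p' s m)
  · rw [IsFiniteRank, (polyRatEquiv V).rank_eq, IsLocalizedModule.rank_eq (nonZeroDivisors ℂ[X])
      le_rfl (LocalizedModule.mkLinearMap (nonZeroDivisors ℂ[X]) (PolyMod V))]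
    exact hV

lemma isCasimir_ratSpace (hV : IsCasimir V) : IsCasimir (RatSpace V) := by
  obtain ⟨μ, hμ⟩ := hV
  refine ⟨μ, LinearMap.ext fun w => ?_⟩
  change ratRep V Lzero (ratRep V Lzero w - w) - ratRep V Lneg (ratRep V Lpos w) = μ • w
  rw [ratRep_zero, ratRep_neg, ratRep_pos]
  induction w using LocalizedModule.induction_on with | _ m s
  have h : shiftDen (0 : ℂ) s = s := Subtype.ext (by simp [shiftDen, shift_apply])
  obtain ⟨v, rfl⟩ := (toPoly V).surjective m
  rw [ratZero_mk, loc_mk_sub_mk, ratZero_mk, ratPos_mk, ratNeg_mk, shiftDen_shiftDen,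
    neg_add_cancel, h, loc_mk_sub_mk, loc_smul_mk]
  congr 1
  exact congrArg (toPoly V) (LinearMap.congr_fun hμ v)

/-- The canonical map `v ↦ v / 1`. -/
def ratIncl : V →ₗ⁅ℂ, sl2⁆ RatSpace V where
  toFun v := LocalizedModule.mk (toPoly V v) 1
  map_add' v w := by
    rw [map_add]
    exact map_add (LocalizedModule.mkLinearMap (nonZeroDivisors ℂ[X]) (PolyMod V)) _ _
  map_smul' c v := by rw [RingHom.id_apply, loc_smul_mk, map_smul]
  map_lie' {x v} := by
    have h1 : ∀ k : ℂ, shiftDen k 1 = 1 := fun k => Subtype.ext (map_one (shift k))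
    have hadd : ∀ a b : PolyMod V, (LocalizedModule.mk (a + b) 1 : RatSpace V) =
        LocalizedModule.mk a 1 + LocalizedModule.mk b 1 :=
      map_add (LocalizedModule.mkLinearMap (nonZeroDivisors ℂ[X]) (PolyMod V))
    have hneg : ∀ a : PolyMod V, (LocalizedModule.mk (-a) 1 : RatSpace V) =
        -LocalizedModule.mk a 1 :=
      map_neg (LocalizedModule.mkLinearMap (nonZeroDivisors ℂ[X]) (PolyMod V))
    change LocalizedModule.mk (toPoly V ⁅x, v⁆) 1 =
      ⁅x, (LocalizedModule.mk (toPoly V v) 1 : RatSpace V)⁆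
    rw [sl2_decomp x]
    simp only [add_lie, smul_lie, neg_lie, map_add, map_smul, map_neg, rat_lie, ratRep_pos,
      ratRep_neg, ratRep_zero, ratPos_mk, ratNeg_mk, ratZero_mk, h1, polyAct_of, hadd, hneg,
      ← loc_smul_mk]

variable {V}

lemma loc_mk_eq_zero (hV : IsTorsionFree V) {m : PolyMod V} {s : nonZeroDivisors ℂ[X]}
    (h : (LocalizedModule.mk m s : RatSpace V) = 0) : m = 0 := by
  rw [← LocalizedModule.zero_mk s, LocalizedModule.mk_eq] at h
  obtain ⟨u, hu⟩ := h
  rw [smul_zero, smul_zero, ← mul_smul] at hu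
  exact (smul_eq_zero_of_isTorsionFree hV hu).resolve_left (nonZeroDivisors.ne_zero (u * s).2)

lemma ratIncl_injective (hV : IsTorsionFree V) : Function.Injective (ratIncl V) := by
  rw [injective_iff_map_eq_zero]
  exact fun v hv => loc_mk_eq_zero hV hv

lemma mk_smul_mk_eq (m : PolyMod V) (s : nonZeroDivisors ℂ[X]) :
    s.1 • (LocalizedModule.mk m s : RatSpace V) = LocalizedModule.mk m 1 := by
  rw [LocalizedModule.smul'_mk]
  exact LocalizedModule.mk_cancel s m

/-- A nonzero submodule of `S⁻¹V` meets `V`. -/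
lemma exists_ratIncl_mem {N : LieSubmodule ℂ sl2 (RatSpace V)} (hN : N ≠ ⊥) :
    ∃ v : V, v ≠ 0 ∧ ratIncl V v ∈ N := by
  rw [Ne, LieSubmodule.eq_bot_iff] at hN
  push Not at hN
  obtain ⟨w, hw, hw0⟩ := hN
  induction w using LocalizedModule.induction_on with | _ m s
  refine ⟨(toPoly V).symm m, fun h => hw0 ?_, ?_⟩
  · rw [(map_eq_zero_iff _ (toPoly V).symm.injective).1 h, LocalizedModule.zero_mk]
  · have h := (polyOfLie N).smul_mem s.1 (mem_polyOfLie.2 hw)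
    have h2 : s.1 • toPoly _ (LocalizedModule.mk m s : RatSpace V) =
        toPoly _ (LocalizedModule.mk m 1 : RatSpace V) := by
      apply (polyRatEquiv V).injective
      rw [map_smul, polyRatEquiv_toPoly, polyRatEquiv_toPoly, mk_smul_mk_eq]
    rw [h2, mem_polyOfLie] at h
    exact h

/-- The rationalization of a simple torsion free module has no proper rational submodules. -/
lemma eq_bot_or_eq_top_of_isRational [LieModule.IsIrreducible ℂ sl2 V]
    (N : LieSubmodule ℂ sl2 (RatSpace V)) (hN : IsRational N) : N = ⊥ ∨ N = ⊤ := by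
  refine or_iff_not_imp_left.2 fun hbot => eq_top_iff.2 fun w _ => ?_
  obtain ⟨v, hv, hvN⟩ := exists_ratIncl_mem hbot
  induction w using LocalizedModule.induction_on with | _ m s
  have hm : ratIncl V ((toPoly V).symm m) ∈ N := map_mem_of_isIrreducible _ hv hvN _
  obtain ⟨-, hdiv, -⟩ := (isRational_iff N).1 hN
  obtain ⟨n, hn⟩ := hdiv s.1 (nonZeroDivisors.ne_zero s.2) (toPoly N ⟨_, hm⟩)
  obtain ⟨n, rfl⟩ := (toPoly N).surjective n
  have h := congrArg (fun z => polyRatEquiv V (polyLin N.incl z)) hn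
  simp only [map_smul, polyLin_toPoly] at h
  rw [polyRatEquiv_toPoly, polyRatEquiv_toPoly] at h
  have h2 : N.incl n = LocalizedModule.mk m s := by
    rw [← sub_eq_zero]
    refine LocalizedModule.eq_zero_of_smul_eq_zero (S := nonZeroDivisors ℂ[X]) s.1 s.2 _ ?_
    rw [smul_sub, h, mk_smul_mk_eq]
    exact sub_self _
  rw [← h2]
  exact n.2

/-- Simple torsion free modules with isomorphic rationalizations are isomorphic. -/
lemma nonempty_equiv_of_ratSpace_equiv {V' : Type u} [AddCommGroup V'] [Module ℂ V']
    [LieRingModule sl2 V'] [LieModule ℂ sl2 V'] [LieModule.IsIrreducible ℂ sl2 V]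
    [LieModule.IsIrreducible ℂ sl2 V'] (hV : IsTorsionFree V) (hV' : IsTorsionFree V')
    (ψ : RatSpace V ≃ₗ⁅ℂ, sl2⁆ RatSpace V') : Nonempty (V ≃ₗ⁅ℂ, sl2⁆ V') := by
  let φ : V →ₗ⁅ℂ, sl2⁆ RatSpace V' := ψ.toLieModuleHom.comp (ratIncl V)
  have hφ : Function.Injective φ := ψ.injective.comp (ratIncl_injective hV)
  have hφ' := ratIncl_injective hV'
  have : Nontrivial V := (LieSubmodule.nontrivial_iff ℂ sl2 V).1 inferInstance
  have hne : φ.range ≠ ⊥ := by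
    obtain ⟨v, hv⟩ := exists_ne (0 : V)
    intro h
    have : φ v ∈ φ.range := (LieModuleHom.mem_range _ _).2 ⟨v, rfl⟩
    rw [h, LieSubmodule.mem_bot] at this
    exact hv (hφ (this.trans (map_zero φ).symm))
  obtain ⟨v', hv', hmem⟩ := exists_ratIncl_mem hne
  -- The images of `V` and `V'` in `S⁻¹V'` are simple and share a nonzero vector, so each contains
  -- the other; `g` is the resulting comparison map.
  have h1 : ∀ w' : V', ratIncl V' w' ∈ φ.range := map_mem_of_isIrreducible _ hv' hmem
  obtain ⟨v, hv⟩ := (LieModuleHom.mem_range _ _).1 hmem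
  have hv0 : v ≠ 0 := by
    rintro rfl
    rw [map_zero] at hv
    exact hv' (hφ' (hv.symm.trans (map_zero _).symm))
  have h2 : ∀ w : V, φ w ∈ (ratIncl V').range := map_mem_of_isIrreducible _ hv0
    ((LieModuleHom.mem_range _ _).2 ⟨v', hv.symm⟩)
  choose g hg using fun w => (LieModuleHom.mem_range _ _).1 (h2 w)
  refine ⟨lieEquivOfBijective
    { toFun := g
      map_add' := fun a b => hφ' (by rw [hg, map_add, map_add, hg, hg])
      map_smul' := fun c a => hφ' (by rw [hg, map_smul, RingHom.id_apply, map_smul, hg])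
      map_lie' := fun {x a} => hφ' (by
        rw [hg, LieModuleHom.map_lie, LieModuleHom.map_lie, hg]) } ⟨fun a b hab => ?_, fun w' => ?_⟩⟩
  · replace hab : g a = g b := hab
    exact hφ (by rw [← hg, ← hg, hab])
  · obtain ⟨w, hw⟩ := (LieModuleHom.mem_range _ _).1 (h1 w')
    exact ⟨w, hφ' (by rw [← hw]; exact hg w)⟩

/-- A rational module is the rationalization of any submodule that spans it over `ℂ(z)`. -/
lemma nonempty_ratSpace_equiv {W : Type u} [AddCommGroup W] [Module ℂ W]
    [LieRingModule sl2 W] [LieModule ℂ sl2 W] (hW : IsRational W) (φ : V →ₗ⁅ℂ, sl2⁆ W)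
    (hφ : Function.Injective φ)
    (hspan : ∀ w : PolyMod W, ∃ p : ℂ[X], p ≠ 0 ∧ ∃ m, polyLin φ m = p • w) :
    Nonempty (RatSpace V ≃ₗ⁅ℂ, sl2⁆ W) := by
  obtain ⟨htf, hdiv, -⟩ := (isRational_iff W).1 hW
  -- Divisibility makes `W` its own rationalization, so it remains to compare `S⁻¹V` with `S⁻¹W`.
  have h1 : Function.Bijective (ratIncl W) := by
    refine ⟨ratIncl_injective htf, fun w => ?_⟩
    induction w using LocalizedModule.induction_on with | _ m s
    obtain ⟨m', rfl⟩ := hdiv s.1 (nonZeroDivisors.ne_zero s.2) m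
    exact ⟨(toPoly W).symm m', (LocalizedModule.mk_cancel s m').symm⟩
  have h2 : Function.Bijective (ratHom φ) := by
    constructor
    · rw [injective_iff_map_eq_zero]
      intro x hx
      induction x using LocalizedModule.induction_on with | _ m s
      rw [ratHom_mk] at hx
      have := loc_mk_eq_zero htf hx
      have hm : m = 0 := polyLin_injective hφ (this.trans (map_zero (polyLin φ)).symm)
      rw [hm, LocalizedModule.zero_mk]
    · intro w
      induction w using LocalizedModule.induction_on with | _ m s
      obtain ⟨p, hp, m', hm'⟩ := hspan m
      let p' : nonZeroDivisors ℂ[X] := ⟨p, mem_nonZeroDivisors_iff_ne_zero.2 hp⟩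
      refine ⟨LocalizedModule.mk m' (p' * s), ?_⟩
      rw [ratHom_mk, ← LocalizedModule.mk_cancel_common_left p' s m]
      exact congrArg (fun z => (LocalizedModule.mk z (p' * s) : RatSpace W)) hm'
  exact ⟨(lieEquivOfBijective _ h2).trans (lieEquivOfBijective _ h1).symm⟩

end RatProperties

/-! ### The socle of an irreducible rational module -/

section Socle

variable {W : Type u} [AddCommGroup W] [Module ℂ W] [LieRingModule sl2 W] [LieModule ℂ sl2 W]

/-- Saturated submodules of rational modules are rational. -/
lemma isRational_of_saturated (hW : IsRational W) (N : LieSubmodule ℂ sl2 W)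
    (hN : ∀ (p : ℂ[X]) (m : PolyMod W), p ≠ 0 → p • m ∈ polyOfLie N → m ∈ polyOfLie N) :
    IsRational N := by
  rw [isRational_iff] at hW ⊢
  obtain ⟨htf, hdiv, hfin⟩ := hW
  have hinj : Function.Injective N.incl := Subtype.val_injective
  refine ⟨isTorsionFree_of_injective hinj htf, fun p hp n => ?_, isFiniteRank_of_injective hinj hfin⟩
  obtain ⟨n, rfl⟩ := (toPoly N).surjective n
  obtain ⟨m, hm⟩ := hdiv p hp (toPoly W n.1)
  have hmN : m ∈ polyOfLie N := hN p m hp (hm ▸ mem_polyOfLie.2 n.2)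
  obtain ⟨w, rfl⟩ := (toPoly W).surjective m
  refine ⟨toPoly N ⟨w, mem_polyOfLie.1 hmN⟩, polyLin_injective hinj ?_⟩
  rw [map_smul]
  exact hm

/-- The saturation of a submodule. -/
def saturation (N : LieSubmodule ℂ sl2 W) : LieSubmodule ℂ sl2 W :=
  lieOfPoly
    { carrier := {m | ∃ p : ℂ[X], p ≠ 0 ∧ p • m ∈ polyOfLie N}
      add_mem' := by
        rintro a b ⟨p, hp, ha⟩ ⟨q, hq, hb⟩
        refine ⟨p * q, mul_ne_zero hp hq, ?_⟩
        rw [smul_add]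
        refine add_mem ?_ ?_
        · rw [mul_comm, mul_smul]; exact Submodule.smul_mem _ _ ha
        · rw [mul_smul]; exact Submodule.smul_mem _ _ hb
      zero_mem' := ⟨1, one_ne_zero, by simp⟩
      smul_mem' := by
        rintro r m ⟨p, hp, hm⟩
        refine ⟨p, hp, ?_⟩
        rw [smul_comm]
        exact Submodule.smul_mem _ _ hm }
    (by
      rintro m ⟨p, hp, hm⟩
      refine ⟨shift 1 p, shift_ne_zero _ hp, ?_⟩
      rw [← polyAct_pos_smul]
      exact polyAct_mem_polyOfLie _ hm)
    (by
      rintro m ⟨p, hp, hm⟩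
      refine ⟨shift (-1) p, shift_ne_zero _ hp, ?_⟩
      rw [← polyAct_neg_smul]
      exact polyAct_mem_polyOfLie _ hm)

lemma mem_polyOfLie_saturation {N : LieSubmodule ℂ sl2 W} {m : PolyMod W} :
    m ∈ polyOfLie (saturation N) ↔ ∃ p : ℂ[X], p ≠ 0 ∧ p • m ∈ polyOfLie N := by
  obtain ⟨w, rfl⟩ := (toPoly W).surjective m
  exact mem_polyOfLie

lemma isRational_saturation (hW : IsRational W) (N : LieSubmodule ℂ sl2 W) :
    IsRational (saturation N) := by
  refine isRational_of_saturated hW _ fun p m hp h => ?_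
  obtain ⟨q, hq, hqm⟩ := mem_polyOfLie_saturation.1 h
  exact mem_polyOfLie_saturation.2 ⟨q * p, mul_ne_zero hq hp, by rwa [mul_smul]⟩

/-- In a rational module without proper rational submodules every nonzero submodule spans. -/
lemma exists_smul_mem (hW : IsRational W)
    (hirr : ∀ N : LieSubmodule ℂ sl2 W, IsRational N → N = ⊥ ∨ N = ⊤)
    {N : LieSubmodule ℂ sl2 W} (hN : N ≠ ⊥) (m : PolyMod W) :
    ∃ p : ℂ[X], p ≠ 0 ∧ p • m ∈ polyOfLie N := by
  have hle : N ≤ saturation N := fun w hw => mem_polyOfLie.1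
    (mem_polyOfLie_saturation.2 ⟨1, one_ne_zero, by rw [one_smul]; exact mem_polyOfLie.2 hw⟩)
  have htop : saturation N = ⊤ := (hirr _ (isRational_saturation hW N)).resolve_left fun h =>
    hN (le_bot_iff.1 (h ▸ hle))
  obtain ⟨w, rfl⟩ := (toPoly W).surjective m
  exact mem_polyOfLie_saturation.1 (mem_polyOfLie.2 (htop ▸ LieSubmodule.mem_top w))

/-- Take a `ℂ(z)`-basis and clear the denominators of the coordinates of `m`. -/
lemma exists_lattice (hW : IsRational W) : ∃ (n : ℕ) (b : Fin n → PolyMod W),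
    ∀ m : PolyMod W, ∃ p : ℂ[X], p ≠ 0 ∧ p • m ∈ Submodule.span ℂ[X] (Set.range b) := by
  obtain ⟨_, _, _⟩ := hW
  let b := Module.finBasis (RatFunc ℂ) (PolyMod W)
  refine ⟨_, b, fun m => ?_⟩
  obtain ⟨p, hp⟩ := IsLocalization.exist_integer_multiples_of_finite (nonZeroDivisors ℂ[X])
    fun i => b.repr m i
  refine ⟨p.1, nonZeroDivisors.ne_zero p.2, ?_⟩
  rw [← b.sum_repr m, Finset.smul_sum]
  refine sum_mem fun i _ => ?_
  obtain ⟨r, hr⟩ := hp i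
  rw [← smul_assoc, ← hr, algebraMap_smul]
  exact Submodule.smul_mem _ _ (Submodule.subset_span ⟨i, rfl⟩)

/-- A surjective semilinear operator maps a lattice onto a submodule containing a multiple of it. -/
lemma exists_smul_eq_of_surjective {ε : ℂ} {T : PolyMod W →ₗ[ℂ] PolyMod W}
    (hT : IsShiftLinear ε T) (hsurj : Function.Surjective T) {n : ℕ} {b : Fin n → PolyMod W}
    (hb : ∀ m : PolyMod W, ∃ p : ℂ[X], p ≠ 0 ∧ p • m ∈ Submodule.span ℂ[X] (Set.range b)) :
    ∃ h : ℂ[X], h ≠ 0 ∧ ∀ i, ∃ l ∈ Submodule.span ℂ[X] (Set.range b), T l = h • b i := by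
  choose u hu using fun i => hsurj (b i)
  choose p hp hpu using fun i => hb (u i)
  refine ⟨shift ε (∏ i, p i), shift_ne_zero _ (Finset.prod_ne_zero_iff.2 fun i _ => hp i),
    fun i => ⟨(∏ i, p i) • u i, ?_, by rw [hT, hu]⟩⟩
  rw [← Finset.prod_erase_mul _ _ (Finset.mem_univ i), mul_smul]
  exact Submodule.smul_mem _ _ (hpu i)

/-- Divide by the polynomial by which `L₁L₋₁` or `L₋₁L₁` acts. -/
lemma polyAct_surjective (hW : IsRational W) (hC : IsCasimir W) :
    Function.Surjective (polyAct W Lpos) ∧ Function.Surjective (polyAct W Lneg) := by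
  obtain ⟨-, hdiv, -⟩ := (isRational_iff W).1 hW
  obtain ⟨μ, hμ⟩ := (isCasimir_iff W).1 hC
  constructor
  · intro m
    obtain ⟨m', rfl⟩ := hdiv _ (X_mul_X_sub_sub_ne_zero 1 μ) m
    exact ⟨_, polyAct_pos_neg_of_casimir hμ m'⟩
  · intro m
    obtain ⟨m', rfl⟩ := hdiv _ (X_mul_X_sub_sub_ne_zero (-1) μ) m
    exact ⟨_, polyAct_neg_pos_of_casimir hμ m'⟩

/-- Some multiple of a lattice lies in all submodules that span. -/
lemma exists_uniform_multiple (hW : IsRational W) (hC : IsCasimir W) {n : ℕ}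
    {b : Fin n → PolyMod W}
    (hb : ∀ m : PolyMod W, ∃ p : ℂ[X], p ≠ 0 ∧ p • m ∈ Submodule.span ℂ[X] (Set.range b)) :
    ∃ P : ℂ[X], P ≠ 0 ∧ ∀ N : LieSubmodule ℂ sl2 W,
      (∀ m : PolyMod W, ∃ p : ℂ[X], p ≠ 0 ∧ p • m ∈ polyOfLie N) →
      ∀ i, P • b i ∈ polyOfLie N := by
  obtain ⟨hs1, hs2⟩ := polyAct_surjective hW hC
  obtain ⟨h₁, h₁0, hh₁⟩ := exists_smul_eq_of_surjective (shiftLinear_pos W) hs1 hb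
  obtain ⟨h₂, h₂0, hh₂⟩ := exists_smul_eq_of_surjective (shiftLinear_neg W) hs2 hb
  obtain ⟨P, hP, hmul⟩ := exists_common_multiple (mul_ne_zero h₁0 h₂0)
  refine ⟨P, hP, fun N hN => ?_⟩
  -- The ideal of multipliers carrying the lattice into `N`. Its generator `g` will satisfy `g ∣ g(z
  -- ± 1) h₁h₂`; the product serves both signs and is independent of `N`.
  let J : Ideal ℂ[X] :=
    { carrier := {q | ∀ i, q • b i ∈ polyOfLie N}
      add_mem' := fun {x y} hx hy i => by rw [add_smul]; exact add_mem (hx i) (hy i)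
      zero_mem' := fun i => by rw [zero_smul]; exact zero_mem _
      smul_mem' := fun c x hx i => by
        rw [smul_eq_mul, mul_smul]; exact Submodule.smul_mem _ _ (hx i) }
  have hspan : ∀ q ∈ J, ∀ l ∈ Submodule.span ℂ[X] (Set.range b), q • l ∈ polyOfLie N := by
    intro q hq l hl
    induction hl using Submodule.span_induction with
    | mem l hl => obtain ⟨i, rfl⟩ := hl; exact hq i
    | zero => rw [smul_zero]; exact zero_mem _
    | add x y _ _ hx hy => rw [smul_add]; exact add_mem hx hy
    | smul r x _ hx => rw [smul_comm]; exact Submodule.smul_mem _ _ hx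
  have hJ0 : ∃ q ∈ J, q ≠ 0 := by
    choose p hp hpb using fun i => hN (b i)
    refine ⟨∏ i, p i, fun i => ?_, Finset.prod_ne_zero_iff.2 fun i _ => hp i⟩
    rw [← Finset.prod_erase_mul _ _ (Finset.mem_univ i), mul_smul]
    exact Submodule.smul_mem _ _ (hpb i)
  have h1 : ∀ q ∈ J, shift 1 q * (h₁ * h₂) ∈ J := by
    intro q hq i
    obtain ⟨l, hl, hlb⟩ := hh₁ i
    rw [mul_comm h₁, mul_left_comm, mul_smul, mul_smul, ← hlb, ← polyAct_pos_smul]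
    exact Submodule.smul_mem _ _ (polyAct_mem_polyOfLie _ (hspan q hq l hl))
  have h2 : ∀ q ∈ J, shift (-1) q * (h₁ * h₂) ∈ J := by
    intro q hq i
    obtain ⟨l, hl, hlb⟩ := hh₂ i
    rw [mul_left_comm, mul_smul, mul_smul, ← hlb, ← polyAct_neg_smul]
    exact Submodule.smul_mem _ _ (polyAct_mem_polyOfLie _ (hspan q hq l hl))
  obtain ⟨g, hg⟩ := IsPrincipalIdealRing.principal J
  have hgmem : ∀ q, q ∈ J ↔ g ∣ q := fun q => by
    rw [hg]; exact Ideal.mem_span_singleton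
  have hgJ : g ∈ J := (hgmem g).2 dvd_rfl
  have hg0 : g ≠ 0 := by
    rintro rfl
    obtain ⟨q, hq, hq0⟩ := hJ0
    exact hq0 (zero_dvd_iff.1 ((hgmem q).1 hq))
  exact (hgmem P).2 (hmul g hg0 ((hgmem _).1 (h1 g hgJ)) ((hgmem _).1 (h2 g hgJ)))

/-- A rational Casimir module without proper rational submodules is the rationalization of a
simple submodule. -/
lemma exists_simple_submodule [Nontrivial W] (hW : IsRational W) (hC : IsCasimir W)
    (hirr : ∀ N : LieSubmodule ℂ sl2 W, IsRational N → N = ⊥ ∨ N = ⊤) :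
    ∃ N : LieSubmodule ℂ sl2 W, LieModule.IsIrreducible ℂ sl2 N ∧
      Nonempty (RatSpace N ≃ₗ⁅ℂ, sl2⁆ W) := by
  obtain ⟨n, b, hb⟩ := exists_lattice hW
  obtain ⟨P, hP, hPb⟩ := exists_uniform_multiple hW hC hb
  have htf := ((isRational_iff W).1 hW).1
  -- Every nonzero submodule contains all `P • b i`, so this intersection does too; it is nonzero
  -- because `b` spans `W` up to multiples.
  let N : LieSubmodule ℂ sl2 W := sInf {N | N ≠ ⊥}
  have hNle : ∀ N' : LieSubmodule ℂ sl2 W, N' ≠ ⊥ → N ≤ N' := fun N' h => sInf_le h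
  have hbN : ∀ i, (toPoly W).symm (P • b i) ∈ N := fun i =>
    (by
      rw [← SetLike.mem_coe, LieSubmodule.coe_sInf]
      exact Set.mem_iInter₂.2 fun N' hN' =>
        mem_polyOfLie.1 (hPb N' (exists_smul_mem hW hirr hN') i))
  have hN : N ≠ ⊥ := by
    intro h
    have hb0 : ∀ i, b i = 0 := fun i => by
      have := hbN i
      rw [h, LieSubmodule.mem_bot] at this
      exact (smul_eq_zero_of_isTorsionFree htf
        ((map_eq_zero_iff _ (toPoly W).symm.injective).1 this)).resolve_left hP
    obtain ⟨w, hw⟩ := exists_ne (0 : W)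
    obtain ⟨p, hp, hpw⟩ := hb (toPoly W w)
    have hbot : Submodule.span ℂ[X] (Set.range b) = ⊥ := by
      rw [Submodule.span_eq_bot]
      rintro _ ⟨i, rfl⟩
      exact hb0 i
    rw [hbot, Submodule.mem_bot] at hpw
    exact hw ((smul_eq_zero_of_isTorsionFree htf hpw).resolve_left hp)
  have hinj : Function.Injective N.incl := Subtype.val_injective
  refine ⟨N, ?_, nonempty_ratSpace_equiv hW N.incl hinj fun m => ?_⟩
  · have : Nontrivial N := (LieSubmodule.nontrivial_iff_ne_bot ℂ sl2 W).2 hN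
    refine LieModule.IsIrreducible.mk fun N' hN' => ?_
    have hmap : N'.map N.incl ≠ ⊥ := by
      intro h
      refine hN' ((LieSubmodule.eq_bot_iff _).2 fun x hx => hinj ?_)
      have : N.incl x ∈ N'.map N.incl := LieSubmodule.mem_map_of_mem hx
      rw [h, LieSubmodule.mem_bot] at this
      rw [this, map_zero]
    refine eq_top_iff.2 fun x _ => ?_
    obtain ⟨y, hy, hyx⟩ := (LieSubmodule.mem_map _).1 (hNle _ hmap x.2)
    rwa [← hinj hyx]
  · obtain ⟨p, hp, hpm⟩ := exists_smul_mem hW hirr hN m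
    obtain ⟨w, hw⟩ := (toPoly W).surjective (p • m)
    rw [← hw, mem_polyOfLie] at hpm
    exact ⟨p, hp, toPoly N ⟨w, hpm⟩, hw⟩

end Socle

/-! ### Irreducible rational modules are Casimir -/

section Casimir

variable {W : Type u} [AddCommGroup W] [Module ℂ W] [LieRingModule sl2 W] [LieModule ℂ sl2 W]

/-- `C` commutes with `L₋₁`, while moving `p` past `L₋₁` shifts it by `-1`. -/
lemma polyCas_neg_pow {m : PolyMod W} {p : ℂ[X]} (hm : polyCas W m = p • m) (n : ℕ) :
    polyCas W ((polyAct W Lneg ^ n) m) = shift (-n) p • (polyAct W Lneg ^ n) m := by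
  induction n with
  | zero => simpa [shift_zero] using hm
  | succ n ih =>
    rw [pow_succ', Module.End.mul_apply, polyCas_neg, ih, polyAct_neg_smul, shift_shift]
    push_cast
    rw [neg_add, add_comm (-1)]

/-- The values `n(n+1)` distinguish the eigenvalues of `C` along the `L₋₁`-string of a vector killed
by `L₁`. -/
lemma eval_zero_shift_neg (n : ℕ) :
    (shift (-n) (X * (X - 1) : ℂ[X])).eval 0 = ((n * (n + 1) : ℕ) : ℂ) := by
  rw [eval_shift]
  simp
  ring

/-- On a rational module `L₁` is injective. -/
lemma polyAct_pos_injective_of_isRational (hW : IsRational W) :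
    Function.Injective (polyAct W Lpos) := by
  obtain ⟨htf, -, hfin⟩ := (isRational_iff W).1 hW
  have : Module.IsTorsionFree ℂ[X] (PolyMod W) := htf
  rw [injective_iff_map_eq_zero]
  intro m hm
  by_contra hm0
  have hcas : polyCas W m = (X * (X - 1) : ℂ[X]) • m := by
    rw [polyCas_apply, hm, map_zero, sub_zero]
  -- Otherwise the string consists of eigenvectors of `C` with distinct eigenvalues in `ℂ[z]`,
  -- against finite rank.
  have hex : ∃ n : ℕ, (polyAct W Lneg ^ n) m = 0 := by
    by_contra! hne
    have hli := Module.End.eigenvectors_linearIndependent' (polyCas W)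
      (fun n : ℕ => shift (-n) (X * (X - 1))) (fun a b hab => by
        have := congrArg (eval 0) hab
        simp only [eval_zero_shift_neg, Nat.cast_inj] at this
        rcases lt_trichotomy a b with h | h | h
        · nlinarith
        · exact h
        · nlinarith)
      (fun n : ℕ => (polyAct W Lneg ^ n) m)
      fun n => ⟨Module.End.mem_eigenspace_iff.2 (polyCas_neg_pow hcas n), hne n⟩
    have h := hli.cardinal_lift_le_rank
    rw [Cardinal.mk_nat, Cardinal.lift_aleph0, Cardinal.lift_uzero] at h
    exact absurd hfin (not_lt.2 h)
  classical
  obtain ⟨k, hk⟩ : ∃ k, Nat.find hex = k + 1 := Nat.exists_eq_succ_of_ne_zero fun h => by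
    have := Nat.find_spec hex
    rw [h] at this
    exact hm0 (by simpa using this)
  have hw0 : (polyAct W Lneg ^ k) m ≠ 0 := Nat.find_min hex (by omega)
  have hw : polyAct W Lneg ((polyAct W Lneg ^ k) m) = 0 := by
    have := Nat.find_spec hex
    rwa [hk, pow_succ', Module.End.mul_apply] at this
  -- The last nonzero vector of the string has eigenvalue `z(z+1)`, being killed by `L₋₁`, and also
  -- `(z-k)(z-k-1)`. The value at `0` forces `k = 0`, and the value at `1` then gives a
  -- contradiction.
  have h := polyAct_pos_neg W ((polyAct W Lneg ^ k) m)
  rw [hw, map_zero, polyCas_neg_pow hcas, eq_comm, sub_eq_zero, smul_left_inj hw0] at h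
  have h0 := congrArg (eval 0) h
  rw [eval_zero_shift_neg] at h0
  have hk0 : k = 0 := by
    have : ((k * (k + 1) : ℕ) : ℂ) = 0 := by rw [← h0]; simp
    have := Nat.cast_eq_zero.1 this
    simpa using this
  subst hk0
  have h1 := congrArg (eval 1) h
  simp [shift_zero] at h1

/-- The Casimir operator of a rational module is algebraic over `ℂ[z]`. -/
lemma exists_aeval_polyCas_eq_zero (hW : IsRational W) :
    ∃ g : ℂ[X][X], g ≠ 0 ∧ aeval (polyCas W) g = 0 := by
  obtain ⟨_, _, _⟩ := hW
  let T : Module.End (RatFunc ℂ) (PolyMod W) :=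
    (polyCas W).extendScalarsOfIsLocalization (nonZeroDivisors ℂ[X]) (RatFunc ℂ)
  have hpow : ∀ (i : ℕ) (m : PolyMod W), (T ^ i) m = (polyCas W ^ i) m := fun i m => by
    rw [Module.End.pow_apply, Module.End.pow_apply]
    rfl
  -- Cayley–Hamilton over `ℂ(z)`, then clearing the denominators of the characteristic polynomial.
  obtain ⟨c, hc, hcp⟩ := IsLocalization.integerNormalization_spec (nonZeroDivisors ℂ[X]) T.charpoly
  refine ⟨IsLocalization.integerNormalization (nonZeroDivisors ℂ[X]) T.charpoly,
    mt IsFractionRing.integerNormalization_eq_zero_iff.1 T.charpoly_monic.ne_zero, ?_⟩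
  set g := IsLocalization.integerNormalization (nonZeroDivisors ℂ[X]) T.charpoly
  have h0 : aeval T (g.map (algebraMap ℂ[X] (RatFunc ℂ))) = 0 := by
    rw [hcp, ← algebraMap_smul (RatFunc ℂ) c, map_smul, T.aeval_self_charpoly, smul_zero]
  refine LinearMap.ext fun m => ?_
  have h1 := LinearMap.congr_fun h0 m
  rw [aeval_map_algebraMap, aeval_eq_sum_range, LinearMap.sum_apply] at h1
  rw [aeval_eq_sum_range, LinearMap.sum_apply]
  simp only [LinearMap.smul_apply, hpow] at h1 ⊢
  exact h1

lemma polyAct_pos_aeval (g : ℂ[X][X]) (m : PolyMod W) :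
    polyAct W Lpos (aeval (polyCas W) g m) =
      aeval (polyCas W) (g.map (shift 1)) (polyAct W Lpos m) := by
  have hpow : ∀ (i : ℕ) (m : PolyMod W),
      polyAct W Lpos ((polyCas W ^ i) m) = (polyCas W ^ i) (polyAct W Lpos m) := by
    intro i
    induction i with
    | zero => intro m; rfl
    | succ i ih =>
      intro m
      rw [pow_succ, Module.End.mul_apply, Module.End.mul_apply, ih, polyCas_pos]
  induction g using Polynomial.induction_on' with
  | add p q hp hq => simp only [map_add, Polynomial.map_add, LinearMap.add_apply, hp, hq]
  | monomial n a =>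
    rw [map_monomial, aeval_monomial, aeval_monomial, Module.End.mul_apply, Module.End.mul_apply,
      Module.algebraMap_end_apply, Module.algebraMap_end_apply, polyAct_pos_smul, hpow]

lemma aeval_polyCas_map_C (G : ℂ[X]) (v : W) :
    aeval (polyCas W) (G.map C) (toPoly W v) = toPoly W (aeval (casimir W) G v) := by
  have hpow : ∀ (i : ℕ) (v : W), (polyCas W ^ i) (toPoly W v) = toPoly W ((casimir W ^ i) v) := by
    intro i
    induction i with
    | zero => intro v; rfl
    | succ i ih =>
      intro v
      rw [pow_succ, pow_succ, Module.End.mul_apply, Module.End.mul_apply, polyCas_toPoly, ih]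
  induction G using Polynomial.induction_on' with
  | add p q hp hq => simp only [map_add, Polynomial.map_add, LinearMap.add_apply, hp, hq]
  | monomial n a =>
    rw [map_monomial, aeval_monomial, aeval_monomial, Module.End.mul_apply, Module.End.mul_apply,
      Module.algebraMap_end_apply, Module.algebraMap_end_apply, hpow, C_smul_polyMod, map_smul]

/-- The Casimir operator of a rational module is algebraic over `ℂ`. -/
lemma exists_aeval_casimir_eq_zero (hW : IsRational W) :
    ∃ G : ℂ[X], G ≠ 0 ∧ aeval (casimir W) G = 0 := by
  have htf := ((isRational_iff W).1 hW).1
  have hinj := polyAct_pos_injective_of_isRational hW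
  obtain ⟨g, ⟨hg0, hg⟩, hmin⟩ := WellFounded.has_min (Polynomial.degree_lt_wf (R := ℂ[X]))
    {g | g ≠ 0 ∧ aeval (polyCas W) g = 0} (exists_aeval_polyCas_eq_zero hW)
  have hshift_inj : Function.Injective (shift (-1)) := taylor_injective (-1)
  set g' := g.map (shift (-1)) with hg'_def
  have hg' : aeval (polyCas W) g' = 0 := by
    refine LinearMap.ext fun m => hinj ?_
    have hmap : g'.map (shift 1) = g := by
      ext1 i
      rw [coeff_map, coeff_map, shift_shift, add_neg_cancel, shift_zero]
    rw [polyAct_pos_aeval, hmap, hg, LinearMap.zero_apply, LinearMap.zero_apply, map_zero]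
  set a := g.leadingCoeff with ha_def
  have ha : a ≠ 0 := leadingCoeff_ne_zero.2 hg0
  have ha' : shift (-1) a ≠ 0 := shift_ne_zero _ ha
  have hdeg' : g'.degree = g.degree := degree_map_eq_of_injective hshift_inj g
  have hlead' : g'.leadingCoeff = shift (-1) a := leadingCoeff_map_of_injective hshift_inj g
  -- The leading terms cancel, so a nonzero difference would be an annihilating polynomial of
  -- smaller degree.
  have hzero : C a * g' - C (shift (-1) a) * g = 0 := by
    by_contra hne
    refine hmin _ ⟨hne, ?_⟩ ?_
    · rw [map_sub, map_mul, map_mul, hg, hg', mul_zero, mul_zero, sub_zero]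
    · have hd : (C a * g').degree = (C (shift (-1) a) * g).degree := by
        rw [degree_C_mul ha, degree_C_mul ha', hdeg']
      have := degree_sub_lt_right hd (mul_ne_zero (C_ne_zero.2 ha') hg0) (by
        rw [leadingCoeff_mul, leadingCoeff_mul, leadingCoeff_C, leadingCoeff_C, hlead', mul_comm])
      rwa [degree_C_mul ha'] at this
  have hcoeff : ∀ i, ∃ t : ℂ, g.coeff i = C t * a := by
    intro i
    -- Comparing coefficients in `hzero` and shifting back by one shows that `g.coeff i / a` has
    -- period one.
    refine eq_C_mul_of_periodic ha ?_
    have h := congrArg (fun q => coeff q i) (sub_eq_zero.1 hzero)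
    simp only [coeff_C_mul, g', coeff_map] at h
    have h2 := congrArg (shift 1) h
    rw [map_mul, map_mul, shift_shift, shift_shift, add_neg_cancel, shift_zero, shift_zero] at h2
    rw [mul_comm, ← h2, mul_comm]
  choose t ht using hcoeff
  let G : ℂ[X] := ∑ i ∈ Finset.range (g.natDegree + 1), monomial i (t i)
  have hG : g = C a * G.map C := by
    ext1 i
    rw [coeff_C_mul, coeff_map, finsetSum_coeff]
    simp only [coeff_monomial, Finset.sum_ite_eq', Finset.mem_range]
    split_ifs with h
    · rw [ht, mul_comm]
    · rw [coeff_eq_zero_of_natDegree_lt (by omega), map_zero, mul_zero]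
  refine ⟨G, ?_, LinearMap.ext fun v => (toPoly W).injective ?_⟩
  · intro h
    rw [h, Polynomial.map_zero, mul_zero] at hG
    exact hg0 hG
  · have h := LinearMap.congr_fun hg (toPoly W v)
    rw [hG, map_mul, aeval_C, Module.End.mul_apply, Module.algebraMap_end_apply,
      aeval_polyCas_map_C] at h
    rw [LinearMap.zero_apply, map_zero]
    exact (smul_eq_zero_of_isTorsionFree htf h).resolve_left ha

/-- Rational modules without proper rational submodules are Casimir. -/
lemma isCasimir_of_isRational [Nontrivial W] (hW : IsRational W)
    (hirr : ∀ N : LieSubmodule ℂ sl2 W, IsRational N → N = ⊥ ∨ N = ⊤) : IsCasimir W := by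
  obtain ⟨htf, hdiv, -⟩ := (isRational_iff W).1 hW
  refine isCasimir_of_spectrum_nonempty W (Set.nonempty_iff_ne_empty.2 fun hspec => ?_)
    (fun μ => hirr _ (isRational_of_saturated hW _ ?_))
    (fun μ => hirr _ (isRational_of_saturated hW _ ?_))
  · obtain ⟨G, hG0, hG⟩ := exists_aeval_casimir_eq_zero hW
    have := isUnit_aeval_of_spectrum_eq_empty hspec hG0
    rw [hG] at this
    exact not_isUnit_zero this
  -- Kernels are saturated by torsion freeness; for ranges, divisibility supplies the preimage and
  -- torsion freeness identifies it.
  · intro p m hp h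
    obtain ⟨w, rfl⟩ := (toPoly W).surjective m
    obtain ⟨w', hw'⟩ := (toPoly W).surjective (p • toPoly W w)
    rw [← hw', mem_polyOfLie, LieModuleHom.mem_ker] at h
    rw [mem_polyOfLie, LieModuleHom.mem_ker]
    have h2 : p • polyLin (casimirSub W μ) (toPoly W w) = 0 := by
      rw [← map_smul, ← hw', polyLin_toPoly, h, map_zero]
    have h3 := (smul_eq_zero_of_isTorsionFree htf h2).resolve_left hp
    exact (map_eq_zero_iff _ (toPoly W).injective).1 h3
  · intro p m hp h
    obtain ⟨w', hw'⟩ := (toPoly W).surjective (p • m)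
    rw [← hw', mem_polyOfLie, LieModuleHom.mem_range] at h
    obtain ⟨u, rfl⟩ := h
    obtain ⟨u', hu'⟩ := hdiv p hp (toPoly W u)
    have h2 : p • (polyLin (casimirSub W μ) u' - m) = 0 := by
      rw [smul_sub, ← map_smul, hu', polyLin_toPoly, hw', sub_self]
    have h3 := sub_eq_zero.1 ((smul_eq_zero_of_isTorsionFree htf h2).resolve_left hp)
    obtain ⟨y, rfl⟩ := (toPoly W).surjective u'
    rw [← h3, polyLin_toPoly, mem_polyOfLie, LieModuleHom.mem_range]
    exact ⟨y, rfl⟩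

end Casimir

/-! ### Isomorphism classes -/

lemma classes_congr {A B : Sl2Mod.{u} → Prop} (h : ∀ V, A V ↔ B V) : classes A = classes B := by
  rw [funext fun V => propext (h V)]

lemma spl_tf_iff (V : Sl2Mod.{u}) : Spl TF V ↔ Spl TFFR V := by
  constructor
  · rintro ⟨h, hirr⟩
    exact ⟨⟨h, isFiniteRank_of_isIrreducible h⟩, hirr⟩
  · rintro ⟨h, hirr⟩
    exact ⟨h.1, hirr⟩

lemma isCasimir_of_splIn_rational {W : Sl2Mod.{u}} (h : SplIn Rational W) :
    IsCasimir W.carrier := by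
  obtain ⟨hW, _, hirr⟩ := h
  exact isCasimir_of_isRational hW hirr

/-- Submodules of Casimir modules are Casimir, so both notions of irreducibility test the same
submodules once the module is known to be Casimir. -/
lemma splIn_rationalCasimir_iff (W : Sl2Mod.{u}) :
    SplIn RationalCasimir W ↔ SplIn Rational W := by
  constructor
  · rintro ⟨⟨hW, hC⟩, hne, hirr⟩
    exact ⟨hW, hne, fun N hN => hirr N
      ⟨hN, isCasimir_of_injective (φ := N.incl) Subtype.val_injective hC⟩⟩
  · intro h
    exact ⟨⟨h.1, isCasimir_of_splIn_rational h⟩, h.2.1, fun N hN => h.2.2 N hN.1⟩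

lemma splIn_rat {V : Sl2Mod.{u}} (h : Spl TFFR V) : SplIn RationalCasimir V.rat := by
  obtain ⟨⟨htf, hfin⟩, hirr⟩ := h
  refine ⟨⟨isRational_ratSpace V.carrier hfin,
    isCasimir_ratSpace V.carrier (isCasimir_of_isIrreducible V.carrier)⟩, ?_,
    fun N hN => eq_bot_or_eq_top_of_isRational N hN.1⟩
  have : Nontrivial V.carrier := (LieSubmodule.nontrivial_iff ℂ sl2 V.carrier).1 inferInstance
  exact (ratIncl_injective htf).nontrivial

lemma exists_spl_rat_equiv {W : Sl2Mod.{u}} (h : SplIn RationalCasimir W) :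
    ∃ V : Sl2Mod.{u}, Spl TFFR V ∧ Nonempty (V.rat.carrier ≃ₗ⁅ℂ, sl2⁆ W.carrier) := by
  obtain ⟨-, _, hirr⟩ := (splIn_rationalCasimir_iff W).1 h
  obtain ⟨hW, hC⟩ := h.1
  obtain ⟨N, hN, he⟩ := exists_simple_submodule hW hC hirr
  obtain ⟨htf, -, hfin⟩ := (isRational_iff W.carrier).1 hW
  exact ⟨W.sub N, ⟨⟨isTorsionFree_of_injective (φ := N.incl) Subtype.val_injective htf,
    isFiniteRank_of_injective (φ := N.incl) Subtype.val_injective hfin⟩, hN⟩, he⟩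

end SlTwo
end

/-! ### The theorem on isomorphism classes -/

theorem mainTheorem2 :
    SlTwo.classes.{u} (SlTwo.Spl SlTwo.TF) = SlTwo.classes (SlTwo.Spl SlTwo.TFFR) ∧
    Set.BijOn SlTwo.ratClass.{u}
      (SlTwo.classes (SlTwo.Spl SlTwo.TFFR))
      (SlTwo.classes (SlTwo.SplIn SlTwo.RationalCasimir)) ∧
    SlTwo.classes.{u} (SlTwo.SplIn SlTwo.RationalCasimir) =
      SlTwo.classes (SlTwo.SplIn SlTwo.Rational) ∧
    ∀ W : SlTwo.Sl2Mod.{u}, SlTwo.SplIn SlTwo.Rational W → SlTwo.IsCasimir W.carrier := by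
  refine ⟨SlTwo.classes_congr SlTwo.spl_tf_iff, ⟨?_, ?_, ?_⟩,
    SlTwo.classes_congr SlTwo.splIn_rationalCasimir_iff,
    fun W => SlTwo.isCasimir_of_splIn_rational⟩
  · rintro _ ⟨V, hV, rfl⟩
    exact ⟨V.rat, SlTwo.splIn_rat hV, rfl⟩
  · rintro _ ⟨V, ⟨hV, hVirr⟩, rfl⟩ _ ⟨V', ⟨hV', hVirr'⟩, rfl⟩ h
    obtain ⟨ψ⟩ : Nonempty (V.rat.carrier ≃ₗ⁅ℂ, SlTwo.sl2⁆ V'.rat.carrier) := Quotient.exact h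
    exact Quotient.sound (SlTwo.nonempty_equiv_of_ratSpace_equiv hV.1 hV'.1 ψ)
  · rintro _ ⟨W, hW, rfl⟩
    obtain ⟨V, hV, he⟩ := SlTwo.exists_spl_rat_equiv hW
    exact ⟨_, ⟨V, hV, rfl⟩, Quotient.sound he⟩
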